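/- Let $\mathbb{K}$ be an algebraically closed field of characteristic zero, let $n\ge 1$, and let $\omega=(\omega_{ij})$, $\omega'=(\omega'_{ij})$ be $n\times n$ matrices with entries in $\mathbb{K}^*$ such that $\omega_{ii}=1$ and $\omega_{ij}\omega_{ji}=1$ for all $i,j$, and likewise for $\omega'$. Let $$S_\omega=\mathbb{K}\langle X_1,\dots,X_n\rangle/\langle X_jX_i-\omega_{ij}X_iX_j : 1\le i,j\le n\rangle,\qquad \deg X_i=1,$$ which is an Ore domain, and let $\mathbb{P}^{n-1}_\omega=\mathrm{Proj}(S_\omega)$. Its function division ring is the degree-zero part of the graded division ring of fractions of $S_\omega$, $$\mathbb{K}(\mathbb{P}^{n-1}_\omega)=\{fg^{-1} : f,g\in S_\omega \text{ homogeneous},\ \deg f=\deg g,\ g\neq 0\},$$ and $\mathbb{P}^{n-1}_\omega$, $\mathbb{P}^{n-1}_{\omega'}$ are called birationally equivalent if $\mathbb{K}(\mathbb{P}^{n-1}_\omega)\cong\mathbb{K}(\mathbb{P}^{n-1}_{\omega'})$ as $\mathbb{K}$-algebras. For $2\le i,j\le n$ put $$q_{ij}=q_{(1ij)}(\omega)=\omega_{1i}\,\omega_{ij}\,\omega_{j1},\qquad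 q'_{ij}=q_{(1ij)}(\omega')=\omega'_{1i}\,\omega'_{ij}\,\omega'_{j1}.$$ Call $q=(q_{ij})_{2\le i,j\le n}$ generic if the quantum torus $T_q=\mathbb{K}\langle Y_2^{\pm1},\dots,Y_n^{\pm1}\rangle/\langle Y_jY_i-q_{ij}Y_iY_j : 2\le i,j\le n\rangle$ is a simple ring. **Theorem.** (1) If there is a matrix $A=(a_{ij})_{2\le i,j\le n}\in GL_{n-1}(\mathbb{Z})$ such that $$q'_{ij}=\prod_{2\le k,l\le n}q_{kl}^{\,a_{ki}a_{lj}}\qquad\text{for all } 2\le i,j\le n,$$ then $\mathbb{P}^{n-1}_\omega$ and $\mathbb{P}^{n-1}_{\omega'}$ are birationally equivalent. (2) Conversely, if $q$ is generic and $\mathbb{P}^{n-1}_\omega$ and $\mathbb{P}^{n-1}_{\omega'}$ are birationally equivalent, then there is a matrix $A\in GL_{n-1}(\mathbb{Z})$ satisfying these equations. -/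

import Mathlib

open scoped nonZeroDivisors

namespace NCProj

universe u

/-! ### Parameters, skew polynomial algebras and quantum tori -/

/-- A multiplicatively antisymmetric `n × n` matrix over `K`:
`ω i i = 1` and `ω i j * ω j i = 1` (so all the entries are nonzero). -/
structure Params (K : Type u) [Field K] (n : ℕ) where
  /-- the matrix -/
  val : Fin n → Fin n → K
  diag : ∀ i, val i i = 1
  mul_swap : ∀ i j, val i j * val j i = 1

section Definitions

variable {K : Type u} [Field K] {n : ℕ}

theorem Params.ne_zero (ω : Params K n) (i j : Fin n) : ω.val i j ≠ 0 :=
  left_ne_zero_of_mul_eq_one (ω.mul_swap i j)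

/-- The relations `X_j X_i = ω_ij X_i X_j` in the free algebra on `X_1, …, X_n`. -/
inductive SkewRel (ω : Params K n) : FreeAlgebra K (Fin n) → FreeAlgebra K (Fin n) → Prop
  | swap (i j : Fin n) : SkewRel ω (FreeAlgebra.ι K j * FreeAlgebra.ι K i)
      (ω.val i j • (FreeAlgebra.ι K i * FreeAlgebra.ι K j))

/-- The skew polynomial algebra
`S_ω = K⟨X_1, …, X_n⟩ / (X_j X_i - ω_ij X_i X_j)`. -/
abbrev SkewPoly (ω : Params K n) : Type u := RingQuot (SkewRel ω)

/-- The generator `X_i` of `S_ω`. -/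
noncomputable def gen (ω : Params K n) (i : Fin n) : SkewPoly ω :=
  RingQuot.mkAlgHom K (SkewRel ω) (FreeAlgebra.ι K i)

/-- The degree `d` part of `S_ω` (with `deg X_i = 1`): the `K`-span of the words of length `d`
in the generators, which is the `d`-th power of the span of the generators. -/
noncomputable def homog (ω : Params K n) (d : ℕ) : Submodule K (SkewPoly ω) :=
  (Submodule.span K (Set.range (gen ω))) ^ d

/-- The relations of the algebra of quantum Laurent polynomials. The letter `(i, true)` stands for
`Y_i` and the letter `(i, false)` for its inverse. -/
inductive TorusRel (q : Params K n) :
    FreeAlgebra K (Fin n × Bool) → FreeAlgebra K (Fin n × Bool) → Prop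
  | mul_inv (i : Fin n) :
      TorusRel q (FreeAlgebra.ι K (i, true) * FreeAlgebra.ι K (i, false)) 1
  | inv_mul (i : Fin n) :
      TorusRel q (FreeAlgebra.ι K (i, false) * FreeAlgebra.ι K (i, true)) 1
  | swap (i j : Fin n) :
      TorusRel q (FreeAlgebra.ι K (j, true) * FreeAlgebra.ι K (i, true))
        (q.val i j • (FreeAlgebra.ι K (i, true) * FreeAlgebra.ι K (j, true)))

/-- The quantum torus `T_q = K⟨Y_1^{±1}, …, Y_n^{±1}⟩ / (Y_j Y_i - q_ij Y_i Y_j)`. -/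
abbrev QuantumTorus (q : Params K n) : Type u := RingQuot (TorusRel q)

/-- `q` is generic when its quantum torus `T_q` is a simple ring. -/
def IsGeneric (q : Params K n) : Prop := IsSimpleRing (QuantumTorus q)

/-- The cyclic number `q_{(ijk)}(ω) = ω_ij ω_jk ω_ki`. -/
def cyc (ω : Params K n) (i j k : Fin n) : K := ω.val i j * ω.val j k * ω.val k i

/-- The matrix of the cyclic numbers `q_{(1ij)}(ω)`, where `i`, `j` run over the indices other than
the first one. The first index is `0 : Fin (m + 1)`, the others are `Fin.succ i` for `i : Fin m`. -/
def cycParams {m : ℕ} (ω : Params K (m + 1)) : Params K m where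
  val i j := cyc ω 0 i.succ j.succ
  diag i := by
    simp only [cyc, ω.diag, mul_one]
    exact ω.mul_swap _ _
  mul_swap i j := by
    simp only [cyc]
    linear_combination (ω.val i.succ j.succ * ω.val j.succ 0 * ω.val 0 j.succ * ω.val j.succ i.succ)
      * ω.mul_swap 0 i.succ + (ω.val j.succ 0 * ω.val 0 j.succ) * ω.mul_swap i.succ j.succ
      + ω.mul_swap j.succ 0

end Definitions

/-! ### `S_ω` is a domain satisfying the Ore conditions

The following facts are needed for the division ring of fractions of `S_ω` to be defined. -/

section Abstract

variable {K : Type u} [Field K] {n : ℕ} {S : Type u} [Ring S] [Algebra K S]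

theorem noZeroDivisors_of_basis (B : Module.Basis (Fin n → ℕ) K S)
    (γ : (Fin n → ℕ) → (Fin n → ℕ) → K) (hγ : ∀ a b, γ a b ≠ 0)
    (hB : ∀ a b, B a * B b = γ a b • B (a + b)) : NoZeroDivisors S := by
  classical
  refine ⟨fun {s t} hst => ?_⟩
  by_contra! hne
  obtain ⟨hs, ht⟩ := hne
  have hs' : (B.repr s).support.Nonempty := by
    rw [Finsupp.support_nonempty_iff]; simpa using hs
  have ht' : (B.repr t).support.Nonempty := by
    rw [Finsupp.support_nonempty_iff]; simpa using ht
  obtain ⟨a0, ha0, b0, hb0, hu⟩ := UniqueSums.uniqueAdd_of_nonempty hs' ht'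
  have h1 : s * t = ∑ a ∈ (B.repr s).support, ∑ b ∈ (B.repr t).support,
      (B.repr s a * B.repr t b * γ a b) • B (a + b) := by
    conv_lhs => rw [← B.linearCombination_repr s, ← B.linearCombination_repr t]
    rw [Finsupp.linearCombination_apply, Finsupp.linearCombination_apply, Finsupp.sum,
      Finsupp.sum, Finset.sum_mul_sum]
    refine Finset.sum_congr rfl fun a _ => Finset.sum_congr rfl fun b _ => ?_
    rw [smul_mul_smul_comm, hB, smul_smul]
  have h2 : B.repr (s * t) (a0 + b0) = B.repr s a0 * B.repr t b0 * γ a0 b0 := by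
    rw [h1]
    simp only [map_sum, map_smul, Module.Basis.repr_self, Finsupp.coe_finsetSum,
      Finset.sum_apply, Finsupp.smul_single, smul_eq_mul, mul_one]
    rw [Finset.sum_eq_single a0, Finset.sum_eq_single b0]
    · simp
    · intro b hb hbne
      rw [Finsupp.single_apply, if_neg]
      intro h
      exact hbne (hu ha0 hb h).2
    · intro h; exact absurd hb0 h
    · intro a ha hane
      refine Finset.sum_eq_zero fun b hb => ?_
      rw [Finsupp.single_apply, if_neg]
      intro h
      exact hane (hu ha hb h).1
    · intro h; exact absurd ha0 h
  rw [hst] at h2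
  simp only [map_zero, Finsupp.coe_zero, Pi.zero_apply] at h2
  exact mul_ne_zero (mul_ne_zero (Finsupp.mem_support_iff.1 ha0) (Finsupp.mem_support_iff.1 hb0))
    (hγ a0 b0) h2.symm

/-- The span of the basis vectors with exponents bounded by `N`. -/
def box (B : Module.Basis (Fin n → ℕ) K S) (N : ℕ) : Submodule K S :=
  Submodule.span K (Set.range fun a : Fin n → Fin (N + 1) => B fun i => (a i : ℕ))

theorem mem_box (B : Module.Basis (Fin n → ℕ) K S) {N : ℕ} {a : Fin n → ℕ} (h : ∀ i, a i ≤ N) :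
    B a ∈ box B N :=
  Submodule.subset_span ⟨fun i => ⟨a i, Nat.lt_succ_of_le (h i)⟩, rfl⟩

theorem exists_mem_box (B : Module.Basis (Fin n → ℕ) K S) (s : S) : ∃ e, s ∈ box B e := by
  classical
  refine ⟨(B.repr s).support.sup fun a => Finset.univ.sup a, ?_⟩
  conv_rhs => rw [← B.linearCombination_repr s]
  rw [Finsupp.linearCombination_apply]
  refine Submodule.sum_mem _ fun a ha => Submodule.smul_mem _ _ (mem_box B fun i => ?_)
  exact (Finset.le_sup (f := a) (Finset.mem_univ i)).trans
    (Finset.le_sup (f := fun a : Fin n → ℕ => Finset.univ.sup a) ha)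

theorem mul_mem_box (B : Module.Basis (Fin n → ℕ) K S)
    (γ : (Fin n → ℕ) → (Fin n → ℕ) → K)
    (hB : ∀ a b, B a * B b = γ a b • B (a + b)) {N e : ℕ} {s t : S}
    (hs : s ∈ box B N) (ht : t ∈ box B e) : s * t ∈ box B (N + e) := by
  have h : box B N * box B e ≤ box B (N + e) := by
    rw [box, box, Submodule.span_mul_span, Submodule.span_le]
    rintro _ ⟨_, ⟨a, rfl⟩, _, ⟨b, rfl⟩, rfl⟩
    simp only [hB]
    refine Submodule.smul_mem _ _ (mem_box B fun i => ?_)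
    have := (a i).2
    have := (b i).2
    simp only [Pi.add_apply]
    omega
  exact h (Submodule.mul_mem_mul hs ht)

theorem finrank_box (B : Module.Basis (Fin n → ℕ) K S) (N : ℕ) :
    Module.finrank K (box B N) = (N + 1) ^ n := by
  have hinj : Function.Injective (fun (a : Fin n → Fin (N + 1)) (i : Fin n) => (a i : ℕ)) := by
    intro a b h
    funext i
    exact Fin.ext (congrFun h i)
  have := finrank_span_eq_card (B.linearIndependent.comp _ hinj)
  rw [Fintype.card_fun, Fintype.card_fin, Fintype.card_fin] at this
  exact this

theorem exists_growth (n e : ℕ) : ∃ N : ℕ, (N + e + 1) ^ n < 2 * (N + 1) ^ n := by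
  have h : Filter.Tendsto (fun N : ℕ => (1 + (e : ℝ) * (1 / ((N : ℝ) + 1))) ^ n) Filter.atTop
      (nhds ((1 + (e : ℝ) * 0) ^ n)) :=
    ((tendsto_one_div_add_atTop_nhds_zero_nat.const_mul _).const_add _).pow n
  rw [mul_zero, add_zero, one_pow] at h
  obtain ⟨N, hN⟩ := (h.eventually (gt_mem_nhds (one_lt_two))).exists
  refine ⟨N, ?_⟩
  have hpos : (0 : ℝ) < (N : ℝ) + 1 := by positivity
  have h2 : ((N : ℝ) + e + 1) ^ n < 2 * ((N : ℝ) + 1) ^ n := by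
    calc ((N : ℝ) + e + 1) ^ n
        = (1 + (e : ℝ) * (1 / ((N : ℝ) + 1))) ^ n * ((N : ℝ) + 1) ^ n := by
          rw [← mul_pow]; congr 1; field_simp; ring
      _ < 2 * ((N : ℝ) + 1) ^ n := by
          exact mul_lt_mul_of_pos_right hN (by positivity)
  exact_mod_cast h2

theorem exists_common (B : Module.Basis (Fin n → ℕ) K S) (φ ψ : S →ₗ[K] S)
    (hφ : Function.Injective φ) (hψ : Function.Injective ψ) (e : ℕ)
    (hφe : ∀ N, ∀ x ∈ box B N, φ x ∈ box B (N + e))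
    (hψe : ∀ N, ∀ x ∈ box B N, ψ x ∈ box B (N + e)) :
    ∃ x y, x ≠ 0 ∧ y ≠ 0 ∧ φ x = ψ y := by
  by_contra! hno
  obtain ⟨N, hN⟩ := exists_growth n e
  let Φ : (box B N × box B N) →ₗ[K] box B (N + e) :=
    (φ.restrict (hφe N)).coprod (-(ψ.restrict (hψe N)))
  have hΦ : Function.Injective Φ := by
    rw [injective_iff_map_eq_zero]
    rintro ⟨⟨x, hx⟩, ⟨y, hy⟩⟩ h
    have h' : φ x = ψ y := by
      have := congrArg (fun z : box B (N + e) => (z : S)) h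
      simpa [Φ, LinearMap.coprod_apply, ← sub_eq_add_neg, sub_eq_zero] using this
    have hx0 : x = 0 := by
      by_contra hx0
      have hy0 : y = 0 := by
        by_contra hy0
        exact hno x y hx0 hy0 h'
      rw [hy0, map_zero] at h'
      exact hx0 (hφ (by rw [h', map_zero]))
    have hy0 : y = 0 := hψ (by rw [← h', hx0, map_zero, map_zero])
    simp [hx0, hy0]
  have h1 : Module.Finite K (box B N) := Module.Finite.span_of_finite K (Set.finite_range _)
  have h2 : Module.Finite K (box B (N + e)) := Module.Finite.span_of_finite K (Set.finite_range _)
  have := LinearMap.finrank_le_finrank_of_injective hΦ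
  rw [Module.finrank_prod, finrank_box, finrank_box] at this
  omega

theorem exists_right_common [NoZeroDivisors S] (B : Module.Basis (Fin n → ℕ) K S)
    (γ : (Fin n → ℕ) → (Fin n → ℕ) → K)
    (hB : ∀ a b, B a * B b = γ a b • B (a + b)) {f g : S} (hf : f ≠ 0) (hg : g ≠ 0) :
    ∃ x y, x ≠ 0 ∧ y ≠ 0 ∧ f * x = g * y := by
  obtain ⟨e1, h1⟩ := exists_mem_box B f
  obtain ⟨e2, h2⟩ := exists_mem_box B g
  have mono : ∀ {N M : ℕ} {x : S}, N ≤ M → x ∈ box B N → x ∈ box B M := by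
    intro N M x hNM hx
    refine Submodule.span_le.2 ?_ hx
    rintro _ ⟨a, rfl⟩
    exact mem_box B fun i => (Nat.lt_succ_iff.1 (a i).2).trans hNM
  refine exists_common B (LinearMap.mulLeft K f) (LinearMap.mulLeft K g)
    (fun x y h => mul_left_cancel₀ hf h) (fun x y h => mul_left_cancel₀ hg h) (e1 + e2)
    (fun N x hx => ?_) (fun N x hx => ?_)
  · exact mono (by omega) (mul_mem_box B γ hB h1 hx)
  · exact mono (by omega) (mul_mem_box B γ hB h2 hx)

theorem exists_left_common [NoZeroDivisors S] (B : Module.Basis (Fin n → ℕ) K S)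
    (γ : (Fin n → ℕ) → (Fin n → ℕ) → K)
    (hB : ∀ a b, B a * B b = γ a b • B (a + b)) {f g : S} (hf : f ≠ 0) (hg : g ≠ 0) :
    ∃ x y, x ≠ 0 ∧ y ≠ 0 ∧ x * f = y * g := by
  obtain ⟨e1, h1⟩ := exists_mem_box B f
  obtain ⟨e2, h2⟩ := exists_mem_box B g
  have mono : ∀ {N M : ℕ} {x : S}, N ≤ M → x ∈ box B N → x ∈ box B M := by
    intro N M x hNM hx
    refine Submodule.span_le.2 ?_ hx
    rintro _ ⟨a, rfl⟩
    exact mem_box B fun i => (Nat.lt_succ_iff.1 (a i).2).trans hNM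
  refine exists_common B (LinearMap.mulRight K f) (LinearMap.mulRight K g)
    (fun x y h => mul_right_cancel₀ hf h) (fun x y h => mul_right_cancel₀ hg h) (e1 + e2)
    (fun N x hx => ?_) (fun N x hx => ?_)
  · exact mono (by omega) (mul_mem_box B γ hB hx h1)
  · exact mono (by omega) (mul_mem_box B γ hB hx h2)

end Abstract

section Basis

variable {K : Type u} [Field K] {n : ℕ} (ω : Params K n)

theorem gen_mul_gen (i j : Fin n) :
    gen ω j * gen ω i = ω.val i j • (gen ω i * gen ω j) := by
  have := RingQuot.mkAlgHom_rel K (SkewRel.swap (ω := ω) i j)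
  rw [map_mul, map_smul, map_mul] at this
  exact this

/-- The product of the generators along a word. -/
noncomputable def word (l : List (Fin n)) : SkewPoly ω := (l.map (gen ω)).prod

theorem word_perm {l l' : List (Fin n)} (h : l.Perm l') :
    ∃ c : K, c ≠ 0 ∧ word ω l = c • word ω l' := by
  induction h with
  | nil => exact ⟨1, one_ne_zero, by simp⟩
  | cons x _ ih =>
    obtain ⟨c, hc, h⟩ := ih
    refine ⟨c, hc, ?_⟩
    simp only [word, List.map_cons, List.prod_cons] at h ⊢
    rw [h, mul_smul_comm]
  | swap x y l =>
    refine ⟨ω.val x y, ω.ne_zero _ _, ?_⟩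
    simp only [word, List.map_cons, List.prod_cons]
    rw [← mul_assoc, gen_mul_gen, smul_mul_assoc, mul_assoc]
  | trans _ _ ih1 ih2 =>
    obtain ⟨c, hc, h⟩ := ih1
    obtain ⟨c', hc', h'⟩ := ih2
    exact ⟨c * c', mul_ne_zero hc hc', by rw [h, h', smul_smul]⟩

theorem word_span : Submodule.span K (Set.range (word ω)) = ⊤ := by
  rw [eq_top_iff]
  rintro s -
  obtain ⟨p, rfl⟩ := RingQuot.mkAlgHom_surjective K (SkewRel ω) s
  induction p using FreeAlgebra.induction with
  | grade0 r =>
    rw [AlgHom.commutes, Algebra.algebraMap_eq_smul_one]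
    exact Submodule.smul_mem _ _ (Submodule.subset_span ⟨[], by simp [word]⟩)
  | grade1 x => exact Submodule.subset_span ⟨[x], by simp [word, gen]⟩
  | mul a b ha hb =>
    rw [map_mul]
    have h : Submodule.span K (Set.range (word ω)) * Submodule.span K (Set.range (word ω)) ≤
        Submodule.span K (Set.range (word ω)) := by
      rw [Submodule.span_mul_span, Submodule.span_le]
      rintro _ ⟨_, ⟨l, rfl⟩, _, ⟨l', rfl⟩, rfl⟩
      exact Submodule.subset_span ⟨l ++ l', by simp [word]⟩
    exact h (Submodule.mul_mem_mul ha hb)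
  | add a b ha hb => rw [map_add]; exact Submodule.add_mem _ ha hb

/-- The scalar picked up when `X_i` is sorted into the monomial with exponent `a`. -/
noncomputable def coef (i : Fin n) (a : Fin n → ℕ) : K :=
  ∏ k, if k < i then ω.val k i ^ a k else 1

theorem coef_ne_zero (i : Fin n) (a : Fin n → ℕ) : coef ω i a ≠ 0 :=
  Finset.prod_ne_zero_iff.2 fun k _ => by
    split_ifs
    · exact pow_ne_zero _ (ω.ne_zero _ _)
    · exact one_ne_zero

theorem coef_add (i j : Fin n) (a : Fin n → ℕ) :
    coef ω i (a + Pi.single j 1) = coef ω i a * if j < i then ω.val j i else 1 := by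
  have : (if j < i then ω.val j i else 1) = ∏ k, if k = j then (if k < i then ω.val k i else 1)
      else 1 := by simp
  rw [this, coef, coef, ← Finset.prod_mul_distrib]
  refine Finset.prod_congr rfl fun k _ => ?_
  by_cases hk : k = j
  · subst hk
    by_cases hki : k < i <;> simp [hki, pow_succ]
  · simp [hk]

/-- The operator by which `X_i` acts on the vector space on the monomials. -/
noncomputable def op (i : Fin n) : ((Fin n → ℕ) →₀ K) →ₗ[K] ((Fin n → ℕ) →₀ K) :=
  Finsupp.lsum K fun a => (coef ω i a) • Finsupp.lsingle (a + Pi.single i 1)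

theorem op_single (i : Fin n) (a : Fin n → ℕ) (r : K) :
    op ω i (Finsupp.single a r) = Finsupp.single (a + Pi.single i 1) (coef ω i a * r) := by
  simp [op]

/-- The action of `S_ω` on the vector space on the monomials. -/
noncomputable def act : SkewPoly ω →ₐ[K] Module.End K ((Fin n → ℕ) →₀ K) :=
  RingQuot.liftAlgHom K ⟨FreeAlgebra.lift K (op ω), by
    rintro _ _ ⟨i, j⟩
    simp only [map_mul, map_smul, FreeAlgebra.lift_ι_apply]
    refine Finsupp.lhom_ext fun a r => ?_
    simp only [Module.End.mul_apply, LinearMap.smul_apply, op_single, Finsupp.smul_single,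
      smul_eq_mul, coef_add]
    rw [add_right_comm]
    congr 1
    rcases lt_trichotomy i j with h | h | h
    · rw [if_pos h, if_neg h.not_gt]; ring
    · subst h; simp [ω.diag]
    · rw [if_neg h.not_gt, if_pos h]
      linear_combination (-(coef ω j a * coef ω i a * r)) * ω.mul_swap i j⟩

theorem act_gen (i : Fin n) : act ω (gen ω i) = op ω i := by
  rw [act, gen, RingQuot.liftAlgHom_mkAlgHom_apply, FreeAlgebra.lift_ι_apply]

/-- The exponent vector of a word. -/
def cnt (l : List (Fin n)) : Fin n → ℕ := fun i => l.count i

theorem act_word (l : List (Fin n)) :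
    ∃ c : K, c ≠ 0 ∧ act ω (word ω l) (Finsupp.single 0 1) = Finsupp.single (cnt l) c := by
  induction l with
  | nil => exact ⟨1, one_ne_zero, by simp [word]; rfl⟩
  | cons x l ih =>
    obtain ⟨c, hc, h⟩ := ih
    refine ⟨coef ω x (cnt l) * c, mul_ne_zero (coef_ne_zero ω _ _) hc, ?_⟩
    have hw : word ω (x :: l) = gen ω x * word ω l := by simp [word]
    rw [hw, map_mul, Module.End.mul_apply, h, act_gen, op_single]
    congr 1
    funext k
    by_cases hk : k = x
    · subst hk; simp [cnt]
    · simp [cnt, hk, List.count_cons_of_ne (Ne.symm hk)]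

theorem exists_cnt (a : Fin n → ℕ) : ∃ l : List (Fin n), cnt l = a := by
  classical
  refine ⟨(∑ i, a i • ({i} : Multiset (Fin n))).toList, ?_⟩
  funext k
  rw [cnt, ← Multiset.coe_count, Multiset.coe_toList, Multiset.count_sum']
  simp [Multiset.count_singleton]

/-- A word with a given exponent vector. -/
noncomputable def mon (a : Fin n → ℕ) : List (Fin n) := (exists_cnt a).choose

theorem cnt_mon (a : Fin n → ℕ) : cnt (mon a) = a := (exists_cnt a).choose_spec

theorem word_eq (l : List (Fin n)) :
    ∃ c : K, c ≠ 0 ∧ word ω l = c • word ω (mon (cnt l)) := by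
  refine word_perm ω (List.perm_iff_count.2 fun k => ?_)
  exact (congrFun (cnt_mon (cnt l)) k).symm

theorem linearIndependent_mon :
    LinearIndependent K fun a : Fin n → ℕ => word ω (mon a) := by
  choose c hc h using fun a : Fin n → ℕ => act_word ω (mon a)
  have hli : LinearIndependent K fun a : Fin n → ℕ =>
      (Finsupp.single a (c a) : (Fin n → ℕ) →₀ K) := by
    have h0 := (Finsupp.basisSingleOne (R := K) (ι := Fin n → ℕ)).linearIndependent.units_smul
      fun a => Units.mk0 (c a) (hc a)
    convert h0 using 2 with a
    simp [Units.smul_def]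
  refine LinearIndependent.of_comp
    ((LinearMap.applyₗ (Finsupp.single 0 1)).comp (act ω).toLinearMap) ?_
  convert hli using 2 with a
  simp only [Function.comp_apply, LinearMap.comp_apply, AlgHom.toLinearMap_apply,
    LinearMap.applyₗ_apply_apply, h, cnt_mon]

theorem span_mon : ⊤ ≤ Submodule.span K (Set.range fun a : Fin n → ℕ => word ω (mon a)) := by
  rw [← word_span ω, Submodule.span_le]
  rintro _ ⟨l, rfl⟩
  obtain ⟨c, -, h⟩ := word_eq ω l
  rw [h]
  exact Submodule.smul_mem _ _ (Submodule.subset_span ⟨_, rfl⟩)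

/-- The basis of monomials of `S_ω`. -/
noncomputable def monBasis : Module.Basis (Fin n → ℕ) K (SkewPoly ω) :=
  Module.Basis.mk (linearIndependent_mon ω) (span_mon ω)

theorem exists_monBasis_mul : ∃ γ : (Fin n → ℕ) → (Fin n → ℕ) → K, (∀ a b, γ a b ≠ 0) ∧
    ∀ a b, monBasis ω a * monBasis ω b = γ a b • monBasis ω (a + b) := by
  choose c hc h using word_eq ω
  refine ⟨fun a b => c (mon a ++ mon b), fun a b => hc _, fun a b => ?_⟩
  simp only [monBasis, Module.Basis.mk_apply]
  have h1 : word ω (mon a) * word ω (mon b) = word ω (mon a ++ mon b) := by simp [word]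
  have h2 : cnt (mon a ++ mon b) = a + b := by
    funext k
    simpa [cnt] using congrArg₂ (· + ·) (congrFun (cnt_mon a) k) (congrFun (cnt_mon b) k)
  rw [h1, h, h2]

instance instNoZeroDivisors : NoZeroDivisors (SkewPoly ω) := by
  obtain ⟨γ, hγ, h⟩ := exists_monBasis_mul ω
  exact noZeroDivisors_of_basis (monBasis ω) γ hγ h

instance instNontrivial : Nontrivial (SkewPoly ω) :=
  ⟨⟨monBasis ω 0, 0, (monBasis ω).ne_zero 0⟩⟩

theorem left_ore (r : SkewPoly ω) (s : (SkewPoly ω)⁰) :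
    ∃ (r' : SkewPoly ω) (s' : (SkewPoly ω)⁰), s' * r = r' * s := by
  by_cases hr : r = 0
  · exact ⟨0, 1, by simp [hr]⟩
  obtain ⟨γ, -, h⟩ := exists_monBasis_mul ω
  obtain ⟨x, y, hx, -, hxy⟩ := exists_left_common (monBasis ω) γ h hr
    (nonZeroDivisors.coe_ne_zero s)
  exact ⟨y, ⟨x, mem_nonZeroDivisors_of_ne_zero hx⟩, hxy⟩

noncomputable instance instOreSet : OreLocalization.OreSet (SkewPoly ω)⁰ :=
  (OreLocalization.nonempty_oreSet_iff_of_noZeroDivisors.2 (left_ore ω)).some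

end Basis

/-! ### Homogeneous components and homogeneous common multiples -/

section Homogeneous

variable {K : Type u} [Field K] {n : ℕ} (ω : Params K n)

open Polynomial in
/-- The algebra map `X_i ↦ X_i t`, which records degrees. -/
noncomputable def degMap : SkewPoly ω →ₐ[K] (SkewPoly ω)[X] :=
  RingQuot.liftAlgHom K ⟨FreeAlgebra.lift K fun i => C (gen ω i) * X, by
    rintro _ _ ⟨i, j⟩
    have key : ∀ a b : SkewPoly ω, (C a * X) * (C b * X) = C (a * b) * X ^ 2 := by
      intro a b
      rw [mul_assoc, ← mul_assoc X, X_mul_C, mul_assoc, ← mul_assoc (C a), ← C_mul, ← pow_two]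
    rw [map_mul, map_smul, map_mul, FreeAlgebra.lift_ι_apply, FreeAlgebra.lift_ι_apply, key, key,
      gen_mul_gen, ← smul_C, smul_mul_assoc]⟩

open Polynomial in
theorem degMap_gen (i : Fin n) : degMap ω (gen ω i) = C (gen ω i) * X := by
  rw [degMap, gen, RingQuot.liftAlgHom_mkAlgHom_apply, FreeAlgebra.lift_ι_apply]
  rfl

open Polynomial in
theorem degMap_word (l : List (Fin n)) :
    degMap ω (word ω l) = C (word ω l) * X ^ l.length := by
  induction l with
  | nil => simp [word]
  | cons x l ih =>
    have hw : word ω (x :: l) = gen ω x * word ω l := by simp [word]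
    rw [hw, map_mul, ih, degMap_gen, List.length_cons, mul_assoc, ← mul_assoc X, X_mul_C, mul_assoc,
      ← mul_assoc (C _) (C _), ← C_mul, ← pow_succ']

theorem word_mem_homog (l : List (Fin n)) : word ω l ∈ homog ω l.length := by
  induction l with
  | nil => simp [word, homog]
  | cons x l ih =>
    have hw : word ω (x :: l) = gen ω x * word ω l := by simp [word]
    rw [hw, homog, List.length_cons, pow_succ']
    exact Submodule.mul_mem_mul (Submodule.subset_span ⟨x, rfl⟩) ih

theorem homog_le (d : ℕ) :
    homog ω d ≤ Submodule.span K (word ω '' {l | l.length = d}) := by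
  induction d with
  | zero =>
    rw [homog, pow_zero, Submodule.one_eq_span, Submodule.span_le, Set.singleton_subset_iff]
    exact Submodule.subset_span ⟨[], rfl, by simp [word]⟩
  | succ d ih =>
    have h : homog ω (d + 1) ≤ Submodule.span K (Set.range (gen ω)) *
        Submodule.span K (word ω '' {l | l.length = d}) := by
      rw [homog, pow_succ']
      exact Submodule.mul_le.2 fun a ha b hb => Submodule.mul_mem_mul ha (ih hb)
    refine h.trans ?_
    rw [Submodule.span_mul_span, Submodule.span_le]
    rintro _ ⟨_, ⟨x, rfl⟩, _, ⟨l, hl, rfl⟩, rfl⟩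
    refine Submodule.subset_span ⟨x :: l, ?_, by simp [word]⟩
    simpa using hl

open Polynomial in
theorem degMap_homog {d : ℕ} {f : SkewPoly ω} (hf : f ∈ homog ω d) :
    degMap ω f = C f * X ^ d := by
  have h := homog_le ω d hf
  clear hf
  induction h using Submodule.span_induction with
  | mem x hx =>
    obtain ⟨l, hl, rfl⟩ := hx
    rw [degMap_word, hl]
  | zero => simp
  | add x y _ _ hx hy => rw [map_add, hx, hy, C_add, add_mul]
  | smul r x _ hx => rw [map_smul, hx, ← smul_mul_assoc, smul_C]

/-- The homogeneous component of degree `d`. -/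
noncomputable def comp (d : ℕ) (s : SkewPoly ω) : SkewPoly ω := (degMap ω s).coeff d

theorem comp_mem (d : ℕ) (s : SkewPoly ω) : comp ω d s ∈ homog ω d := by
  have h : s ∈ Submodule.span K (Set.range (word ω)) := by rw [word_span]; trivial
  induction h using Submodule.span_induction with
  | mem x hx =>
    obtain ⟨l, rfl⟩ := hx
    rw [comp, degMap_word, Polynomial.coeff_C_mul_X_pow]
    split_ifs with hd
    · rw [hd]; exact word_mem_homog ω l
    · exact Submodule.zero_mem _
  | zero => simp [comp]
  | add x y _ _ hx hy =>
    have : comp ω d (x + y) = comp ω d x + comp ω d y := by simp [comp]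
    rw [this]; exact Submodule.add_mem _ hx hy
  | smul r x _ hx =>
    have : comp ω d (r • x) = r • comp ω d x := by simp [comp]
    rw [this]; exact Submodule.smul_mem _ _ hx

theorem exists_comp_ne_zero {s : SkewPoly ω} (hs : s ≠ 0) : ∃ d, comp ω d s ≠ 0 := by
  by_contra! h
  have h0 : degMap ω s = 0 := Polynomial.ext fun d => by simpa [comp] using h d
  have key : ∀ s : SkewPoly ω, (degMap ω s).eval 1 = s := by
    intro s
    have h : s ∈ Submodule.span K (Set.range (word ω)) := by rw [word_span]; trivial
    induction h using Submodule.span_induction with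
    | mem x hx =>
      obtain ⟨l, rfl⟩ := hx
      rw [degMap_word, Polynomial.C_mul_X_pow_eq_monomial, Polynomial.eval_monomial]
      simp
    | zero => simp
    | add x y _ _ hx hy => rw [map_add, Polynomial.eval_add, hx, hy]
    | smul r x _ hx => rw [map_smul, Polynomial.eval_smul, hx]
  apply hs
  rw [← key s, h0, Polynomial.eval_zero]

theorem comp_mul {d : ℕ} {f : SkewPoly ω} (hf : f ∈ homog ω d) (k : ℕ) (s : SkewPoly ω) :
    comp ω (d + k) (f * s) = f * comp ω k s := by
  rw [comp, map_mul, degMap_homog ω hf, mul_assoc, Polynomial.coeff_C_mul, add_comm d k,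
    Polynomial.X_pow_mul, Polynomial.coeff_mul_X_pow]
  rfl

theorem mul_comp {e : ℕ} {g : SkewPoly ω} (hg : g ∈ homog ω e) (k : ℕ) (s : SkewPoly ω) :
    comp ω (e + k) (s * g) = comp ω k s * g := by
  rw [comp, map_mul, degMap_homog ω hg, ← mul_assoc, add_comm e k, Polynomial.coeff_mul_X_pow,
    Polynomial.coeff_mul_C]
  rfl

theorem homog_mul {d e : ℕ} {f g : SkewPoly ω} (hf : f ∈ homog ω d) (hg : g ∈ homog ω e) :
    f * g ∈ homog ω (d + e) := by
  rw [homog, pow_add]; exact Submodule.mul_mem_mul hf hg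

theorem homog_one : (1 : SkewPoly ω) ∈ homog ω 0 := by
  have := word_mem_homog ω []
  simpa [word] using this

/-- Homogeneous right common multiples. -/
theorem exists_homog_common {d e : ℕ} {f g : SkewPoly ω} (hf : f ∈ homog ω d)
    (hg : g ∈ homog ω e) (hg0 : g ≠ 0) :
    ∃ k, ∃ x ∈ homog ω (e + k), ∃ y ∈ homog ω (d + k), x ≠ 0 ∧ f * x = g * y := by
  by_cases hf0 : f = 0
  · exact ⟨0, g, by simpa using hg, 0, Submodule.zero_mem _, hg0, by simp [hf0]⟩
  obtain ⟨γ, -, h⟩ := exists_monBasis_mul ω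
  obtain ⟨x, y, hx, -, hxy⟩ := exists_right_common (monBasis ω) γ h hf0 hg0
  obtain ⟨k, hk⟩ := exists_comp_ne_zero ω hx
  refine ⟨k, comp ω (e + k) (x * g), comp_mem ω _ _, comp ω (d + k) (y * g), comp_mem ω _ _,
    ?_, ?_⟩
  · rw [mul_comp ω hg]
    exact mul_ne_zero hk hg0
  · rw [← comp_mul ω hf, ← comp_mul ω hg, ← mul_assoc, ← mul_assoc, hxy, add_left_comm]

end Homogeneous

/-! ### The function division ring -/

section FunctionRing

variable {K : Type u} [Field K] {n : ℕ}

/-- The division ring of fractions of the Ore domain `S_ω`. -/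
abbrev Frac (ω : Params K n) : Type u := OreLocalization (SkewPoly ω)⁰ (SkewPoly ω)

/-- The inclusion of `S_ω` into its division ring of fractions. -/
noncomputable def toFrac (ω : Params K n) : SkewPoly ω →+* Frac ω :=
  OreLocalization.numeratorRingHom

theorem toFrac_ne_zero (ω : Params K n) {g : SkewPoly ω} (hg : g ≠ 0) : toFrac ω g ≠ 0 := by
  have h := OreLocalization.numerator_isUnit
    (⟨g, mem_nonZeroDivisors_of_ne_zero hg⟩ : (SkewPoly ω)⁰)
  exact h.ne_zero

/-- The function division ring of `ℙ_ω^{n-1}`: the `K`-subalgebra of the fractions `f g⁻¹` with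
`f`, `g` homogeneous of the same degree and `g ≠ 0`. Homogeneous fractions are formed inside the
full division ring of fractions, which contains the graded one. -/
noncomputable def functionRing (ω : Params K n) : Subalgebra K (Frac ω) where
  carrier := {z | ∃ d, ∃ f ∈ homog ω d, ∃ g ∈ homog ω d, g ≠ 0 ∧
    z = toFrac ω f * (toFrac ω g)⁻¹}
  mul_mem' := by
    rintro _ _ ⟨d, f, hf, g, hg, hg0, rfl⟩ ⟨d', f', hf', g', hg', hg0', rfl⟩
    obtain ⟨k, x, hx, y, hy, hx0, hxy⟩ := exists_homog_common ω hf' hg hg0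
    refine ⟨d + (d' + k), f * y, homog_mul ω hf hy, g' * x, ?_, mul_ne_zero hg0' hx0, ?_⟩
    · rw [add_left_comm]; exact homog_mul ω hg' hx
    have hG := toFrac_ne_zero ω hg0
    have hX := toFrac_ne_zero ω hx0
    have h : (toFrac ω g)⁻¹ * toFrac ω f' = toFrac ω y * (toFrac ω x)⁻¹ := by
      rw [eq_mul_inv_iff_mul_eq₀ hX, mul_assoc, inv_mul_eq_iff_eq_mul₀ hG, ← map_mul, ← map_mul,
        hxy]
    rw [map_mul, map_mul, mul_inv_rev, mul_assoc, ← mul_assoc _ (toFrac ω f'), h, mul_assoc,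
      mul_assoc]
  add_mem' := by
    rintro _ _ ⟨d, f, hf, g, hg, hg0, rfl⟩ ⟨d', f', hf', g', hg', hg0', rfl⟩
    obtain ⟨k, x, hx, y, hy, hx0, hxy⟩ := exists_homog_common ω hg hg' hg0'
    have hy0 : y ≠ 0 := by
      rintro rfl
      rw [mul_zero] at hxy
      exact mul_ne_zero hg0 hx0 hxy
    refine ⟨d + (d' + k), f * x + f' * y, Submodule.add_mem _ (homog_mul ω hf hx) ?_, g * x,
      homog_mul ω hg hx, mul_ne_zero hg0 hx0, ?_⟩
    · rw [add_left_comm]; exact homog_mul ω hf' hy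
    have hX := toFrac_ne_zero ω hx0
    have hY := toFrac_ne_zero ω hy0
    rw [map_add, add_mul]
    congr 1
    · rw [map_mul, map_mul, mul_inv_rev, mul_assoc, ← mul_assoc _ _ (toFrac ω g)⁻¹,
        mul_inv_cancel₀ hX, one_mul]
    · rw [hxy, map_mul, map_mul, mul_inv_rev, mul_assoc, ← mul_assoc _ _ (toFrac ω g')⁻¹,
        mul_inv_cancel₀ hY, one_mul]
  algebraMap_mem' r := by
    refine ⟨0, algebraMap K _ r, ?_, 1, homog_one ω, one_ne_zero, ?_⟩
    · rw [Algebra.algebraMap_eq_smul_one]; exact Submodule.smul_mem _ _ (homog_one ω)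
    · rw [map_one, inv_one, mul_one]; rfl

/-- `ℙ_ω` and `ℙ_ω'` are birationally equivalent when their function division rings are
isomorphic as `K`-algebras. -/
def Birational (ω ω' : Params K n) : Prop :=
  Nonempty (functionRing ω ≃ₐ[K] functionRing ω')

end FunctionRing

end NCProj

namespace NCProj

universe u

/-! ### The alternating bicharacter of a multiplicatively antisymmetric matrix -/

section Pairing

variable {K : Type u} [Field K] {n : ℕ} (ω : Params K n)

/-- An entry of `ω`, as an element of the additive version of the group of units. -/
def entry (i j : Fin n) : Additive Kˣ :=
  Additive.ofMul (Units.mk0 (ω.val i j) (ω.ne_zero i j))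

/-- The bicharacter `(a, b) ↦ ∏ k l, ω_kl ^ (a_k b_l)` of `ℤ ^ n`, written additively. -/
def pairing : (Fin n → ℤ) →ₗ[ℤ] (Fin n → ℤ) →ₗ[ℤ] Additive Kˣ :=
  LinearMap.mk₂ ℤ (fun a b => ∑ k, ∑ l, (a k * b l) • entry ω k l)
    (fun a a' b => by
      simp only [Pi.add_apply, add_mul, add_zsmul, Finset.sum_add_distrib])
    (fun c a b => by
      simp only [Pi.smul_apply, smul_eq_mul, mul_assoc, mul_smul c, Finset.smul_sum])
    (fun a b b' => by
      simp only [Pi.add_apply, mul_add, add_zsmul, Finset.sum_add_distrib])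
    (fun c a b => by
      simp only [Pi.smul_apply, smul_eq_mul, mul_left_comm _ c, mul_smul c, Finset.smul_sum])

theorem pairing_apply (a b : Fin n → ℤ) :
    pairing ω a b = ∑ k, ∑ l, (a k * b l) • entry ω k l := rfl

theorem pairing_single (i j : Fin n) :
    pairing ω (Pi.single i 1) (Pi.single j 1) = entry ω i j := by
  rw [pairing_apply, Finset.sum_eq_single i, Finset.sum_eq_single j]
  · simp
  · intro l _ hl; simp [hl]
  · simp
  · intro k _ hk; simp [hk]
  · simp

theorem entry_swap (i j : Fin n) : entry ω i j = - entry ω j i := by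
  rw [eq_neg_iff_add_eq_zero]
  exact congrArg Additive.ofMul (Units.ext (ω.mul_swap i j))

theorem pairing_swap (a b : Fin n → ℤ) : pairing ω a b = - pairing ω b a := by
  rw [pairing_apply, pairing_apply, Finset.sum_comm, ← Finset.sum_neg_distrib]
  refine Finset.sum_congr rfl fun l _ => ?_
  rw [← Finset.sum_neg_distrib]
  refine Finset.sum_congr rfl fun k _ => ?_
  rw [entry_swap, zsmul_neg, mul_comm]

/-- The values of the bicharacter in the field. -/
def chi (a b : Fin n → ℤ) : K := ((pairing ω a b).toMul : Kˣ)

theorem chi_eq_prod (a b : Fin n → ℤ) :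
    chi ω a b = ∏ k, ∏ l, ω.val k l ^ (a k * b l) := by
  simp [chi, pairing_apply, entry, toMul_sum, Units.coe_prod]

theorem chi_ne_zero (a b : Fin n → ℤ) : chi ω a b ≠ 0 := Units.ne_zero _

@[simp] theorem chi_single (i j : Fin n) :
    chi ω (Pi.single i 1) (Pi.single j 1) = ω.val i j := by
  rw [chi, pairing_single]; rfl

theorem chi_add_left (a a' b : Fin n → ℤ) : chi ω (a + a') b = chi ω a b * chi ω a' b := by
  simp [chi]

theorem chi_add_right (a b b' : Fin n → ℤ) : chi ω a (b + b') = chi ω a b * chi ω a b' := by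
  simp [chi]

theorem chi_neg_left (a b : Fin n → ℤ) : chi ω (-a) b = (chi ω a b)⁻¹ := by simp [chi]

theorem chi_neg_right (a b : Fin n → ℤ) : chi ω a (-b) = (chi ω a b)⁻¹ := by simp [chi]

@[simp] theorem chi_zero_left (b : Fin n → ℤ) : chi ω 0 b = 1 := by simp [chi]

theorem chi_eq_iff {n' : ℕ} (ω' : Params K n') (a b : Fin n → ℤ) (a' b' : Fin n' → ℤ) :
    chi ω a b = chi ω' a' b' ↔ pairing ω a b = pairing ω' a' b' :=
  Units.val_inj.trans Additive.toMul.injective.eq_iff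

end Pairing

/-! ### Laurent monomials in a division ring that contains `S_ω` -/

section Monomials

variable {K : Type u} [Field K] {n : ℕ} (ω : Params K n)
  {D : Type*} [DivisionRing D] [Algebra K D] (f : SkewPoly ω →ₐ[K] D)

variable {ω} in
/-- `IsMonomial f a u` says that `u` is a nonzero multiple of the Laurent monomial with
exponent `a`. -/
inductive IsMonomial : (Fin n → ℤ) → D → Prop
  | algebraMap {c : K} (hc : c ≠ 0) : IsMonomial 0 (algebraMap K _ c)
  | gen (i : Fin n) : IsMonomial (Pi.single i 1) (f (gen ω i))
  | mul {a b : Fin n → ℤ} {u v : D} (hu : IsMonomial a u) (hv : IsMonomial b v) :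
    IsMonomial (a + b) (u * v)
  | inv {a : Fin n → ℤ} {u : D} (hu : IsMonomial a u) : IsMonomial (-a) u⁻¹

theorem monBasis_apply (a : Fin n → ℕ) : monBasis ω a = word ω (mon a) := by
  simp [monBasis]

theorem gen_ne_zero (i : Fin n) : gen ω i ≠ 0 := by
  obtain ⟨c, hc, h⟩ := word_eq ω [i]
  have : gen ω i = c • monBasis ω (cnt [i]) := by simpa [word, monBasis_apply] using h
  rw [this]
  exact smul_ne_zero hc ((monBasis ω).ne_zero _)

variable {ω} {f}

theorem map_ne_zero_of (hf : Function.Injective f) {s : SkewPoly ω} (hs : s ≠ 0) : f s ≠ 0 :=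
  (map_ne_zero_iff f hf).2 hs

theorem IsMonomial.ne_zero (hf : Function.Injective f) {a : Fin n → ℤ} {u : D} (h : IsMonomial f a u) : u ≠ 0 := by
  induction h with
  | algebraMap hc => simpa using hc
  | gen i => exact map_ne_zero_of hf (gen_ne_zero ω i)
  | mul _ _ h h' => exact mul_ne_zero h h'
  | inv _ h => exact inv_ne_zero h

theorem IsMonomial.one : IsMonomial f 0 1 := by
  simpa using IsMonomial.algebraMap (f := f) one_ne_zero

theorem IsMonomial.smul {a : Fin n → ℤ} {u : D} (h : IsMonomial f a u) {c : K}
    (hc : c ≠ 0) : IsMonomial f a (c • u) := by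
  simpa [Algebra.smul_def] using (IsMonomial.algebraMap hc).mul h

theorem mul_inv_comm_of_comm {u v : D} {c : K}
    (hc : c ≠ 0) (hu : u ≠ 0) (h : v * u = c • (u * v)) : v * u⁻¹ = c⁻¹ • (u⁻¹ * v) := by
  rw [mul_inv_eq_iff_eq_mul₀ hu, smul_mul_assoc, mul_assoc, h, mul_smul_comm, smul_smul,
    inv_mul_cancel₀ hc, one_smul, inv_mul_cancel_left₀ hu]

/-- `q`-commutation of monomials. -/
theorem IsMonomial.comm (hf : Function.Injective f) {a b : Fin n → ℤ} {u v : D} (hu : IsMonomial f a u)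
    (hv : IsMonomial f b v) : v * u = chi ω a b • (u * v) := by
  have key : ∀ (v : D) (b : Fin n → ℤ),
      (∀ i, v * f (NCProj.gen ω i) =
        chi ω (Pi.single i 1) b • (f (NCProj.gen ω i) * v)) →
      ∀ {a u}, IsMonomial f a u → v * u = chi ω a b • (u * v) := by
    intro v b h a u hu
    induction hu with
    | algebraMap _ => rw [chi_zero_left, one_smul, Algebra.commutes]
    | gen i => exact h i
    | mul _ _ h1 h2 =>
      rw [← mul_assoc, h1, smul_mul_assoc, mul_assoc, h2, mul_smul_comm, smul_smul, chi_add_left,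
        mul_assoc]
    | inv h1 h2 => rw [mul_inv_comm_of_comm (chi_ne_zero _ _ _) (h1.ne_zero hf) h2, chi_neg_left]
  refine key v b (fun i => ?_) hu
  have h2 := key (f (NCProj.gen ω i)) (Pi.single i 1) (fun j => by
    rw [← map_mul, gen_mul_gen, map_smul, map_mul, chi_single]) hv
  rw [h2, smul_smul, ← chi_ne_zero ω (Pi.single i 1) b |>.isUnit.unit_spec]
  have : chi ω (Pi.single i 1) b * chi ω b (Pi.single i 1) = 1 := by
    rw [chi, chi, pairing_swap]; simp
  rw [IsUnit.unit_spec, this, one_smul]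

theorem IsMonomial.word (l : List (Fin n)) :
    IsMonomial f (fun i => (cnt l i : ℤ)) (f (word ω l)) := by
  induction l with
  | nil =>
    convert IsMonomial.one (f := f) using 1
    · funext k; simp [cnt]
    · simp [NCProj.word]
  | cons x l ih =>
    convert (IsMonomial.gen x).mul ih using 1
    · funext k
      by_cases hk : k = x
      · subst hk; simp [cnt, add_comm]
      · simp [cnt, hk, List.count_cons_of_ne (Ne.symm hk)]
    · simp [NCProj.word]

theorem IsMonomial.monBasis (a : Fin n → ℕ) :
    IsMonomial f (fun i => (a i : ℤ)) (f (monBasis ω a)) := by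
  have := IsMonomial.word (f := f) (mon a)
  rwa [cnt_mon, ← monBasis_apply] at this

theorem exists_toFrac_monBasis_mul (a b : Fin n → ℕ) : ∃ k : K, k ≠ 0 ∧
    f (NCProj.monBasis ω a) * f (NCProj.monBasis ω b) =
      k • f (NCProj.monBasis ω (a + b)) := by
  obtain ⟨γ, h0, h⟩ := exists_monBasis_mul ω
  exact ⟨γ a b, h0 a b, by rw [← map_mul, h, map_smul]⟩

theorem IsMonomial.exists_mul_eq (hf : Function.Injective f) {a : Fin n → ℤ} {u : D} (h : IsMonomial f a u) :
    ∃ c d : Fin n → ℕ, ∃ k : K, k ≠ 0 ∧ (∀ i, a i = c i - d i) ∧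
      u * f (NCProj.monBasis ω d) = k • f (NCProj.monBasis ω c) := by
  induction h with
  | @algebraMap c hc => exact ⟨0, 0, c, hc, by simp, by rw [Algebra.smul_def]⟩
  | gen i =>
    obtain ⟨k, hk, h⟩ := word_eq ω [i]
    obtain ⟨k', hk', h'⟩ := word_eq ω []
    have e : cnt ([] : List (Fin n)) = 0 := by funext; simp [cnt]
    have e1 : (1 : SkewPoly ω) = k' • NCProj.monBasis ω 0 := by
      rw [monBasis_apply, ← e, ← h']; simp [NCProj.word]
    refine ⟨cnt [i], 0, k'⁻¹ * k, mul_ne_zero (inv_ne_zero hk') hk, fun j => ?_, ?_⟩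
    · by_cases hj : j = i
      · subst hj; simp [cnt]
      · simp [cnt, hj, List.count_cons_of_ne (Ne.symm hj)]
    · rw [← map_mul, ← map_smul, mul_smul, monBasis_apply ω (cnt _), ← h,
        ← inv_smul_eq_iff₀ hk' |>.2 e1]
      simp [NCProj.word]
  | @mul a b u v _ _ h h' =>
    obtain ⟨c, d, k, hk, e, h⟩ := h
    obtain ⟨c', d', k', hk', e', h'⟩ := h'
    obtain ⟨r, hr, h1⟩ := exists_toFrac_monBasis_mul (f := f) d' d
    obtain ⟨r', hr', h2⟩ := exists_toFrac_monBasis_mul (f := f) c c'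
    obtain ⟨t, ht, h3⟩ : ∃ t : K, t ≠ 0 ∧ f (NCProj.monBasis ω c') * f (NCProj.monBasis ω d) =
        t • (f (NCProj.monBasis ω d) * f (NCProj.monBasis ω c')) :=
      ⟨_, chi_ne_zero ω _ _, (IsMonomial.monBasis d).comm hf (IsMonomial.monBasis c')⟩
    refine ⟨c + c', d' + d, r⁻¹ * (k' * (t * (k * r'))), mul_ne_zero (inv_ne_zero hr)
      (mul_ne_zero hk' (mul_ne_zero ht (mul_ne_zero hk hr'))), fun i => ?_, ?_⟩
    · simp [e, e']; ring
    · rw [← inv_smul_eq_iff₀ hr |>.2 h1, mul_smul, mul_smul_comm, mul_assoc, ← mul_assoc v, h',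
        smul_mul_assoc, h3, mul_smul_comm, mul_smul_comm, ← mul_assoc, h, smul_mul_assoc, h2]
      simp only [smul_smul]
  | @inv a u hu h =>
    obtain ⟨c, d, k, hk, e, h⟩ := h
    refine ⟨d, c, k⁻¹, inv_ne_zero hk, fun i => by simp [e], ?_⟩
    rw [← inv_smul_eq_iff₀ hk |>.2 h, mul_smul_comm, inv_mul_cancel_left₀ (hu.ne_zero hf)]

/-- The monomial with a given exponent is unique up to a scalar. -/
theorem IsMonomial.exists_eq_smul (hf : Function.Injective f) {a : Fin n → ℤ} {u v : D} (hu : IsMonomial f a u)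
    (hv : IsMonomial f a v) : ∃ k : K, k ≠ 0 ∧ u = k • v := by
  obtain ⟨c, d, k, hk, e, h⟩ := hu.exists_mul_eq hf
  obtain ⟨c', d', k', hk', e', h'⟩ := hv.exists_mul_eq hf
  obtain ⟨r, hr, h1⟩ := exists_toFrac_monBasis_mul (f := f) c d'
  obtain ⟨r', hr', h2⟩ := exists_toFrac_monBasis_mul (f := f) c' d
  obtain ⟨s, hs, h3⟩ := exists_toFrac_monBasis_mul (f := f) d d'
  obtain ⟨s', hs', h4⟩ := exists_toFrac_monBasis_mul (f := f) d' d
  have hcd : c + d' = c' + d := by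
    funext i
    have := e i
    have := e' i
    simp only [Pi.add_apply]
    omega
  have hB := map_ne_zero_of hf ((NCProj.monBasis ω).ne_zero (d + d'))
  have E1 : u * (s • f (NCProj.monBasis ω (d + d'))) =
      (k * r) • f (NCProj.monBasis ω (c + d')) := by
    rw [← h3, ← mul_assoc, h, smul_mul_assoc, h1, smul_smul]
  have E2 : v * (s' • f (NCProj.monBasis ω (d + d'))) =
      (k' * r') • f (NCProj.monBasis ω (c + d')) := by
    rw [add_comm d d', ← h4, ← mul_assoc, h', smul_mul_assoc, h2, smul_smul, hcd]
  rw [mul_smul_comm, ← eq_inv_smul_iff₀ hs] at E1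
  rw [mul_smul_comm, ← eq_inv_smul_iff₀ hs', smul_smul, ← inv_smul_eq_iff₀
    (mul_ne_zero (inv_ne_zero hs') (mul_ne_zero hk' hr'))] at E2
  refine ⟨s⁻¹ * (k * r) * (s'⁻¹ * (k' * r'))⁻¹, ?_, mul_right_cancel₀ hB ?_⟩
  rotate_left
  · rw [E1, ← E2, smul_smul, smul_smul, smul_mul_assoc]
  · exact mul_ne_zero (mul_ne_zero (inv_ne_zero hs) (mul_ne_zero hk hr))
      (inv_ne_zero (mul_ne_zero (inv_ne_zero hs') (mul_ne_zero hk' hr')))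

/-- Monomials with different exponents are linearly independent. -/
theorem IsMonomial.linearIndependent (hf : Function.Injective f) {ι : Type*} {a : ι → Fin n → ℤ} {u : ι → D}
    (hu : ∀ i, IsMonomial f (a i) (u i)) (ha : Function.Injective a) :
    LinearIndependent K u := by
  rw [linearIndependent_iff']
  intro s g hg i hi
  let N : Fin n → ℕ := fun j => ∑ i ∈ s, (a i j).natAbs
  let e : ι → Fin n → ℕ := fun i j => (a i j + N j).toNat
  have he : ∀ i ∈ s, ∀ j, (e i j : ℤ) = a i j + N j := fun i hi j => by
    have : (a i j).natAbs ≤ N j :=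
      Finset.single_le_sum (f := fun i => (a i j).natAbs) (fun _ _ => Nat.zero_le _) hi
    simp only [e]
    omega
  have h1 : ∀ i : s, ∃ k : K, k ≠ 0 ∧
      u i * f (NCProj.monBasis ω N) = k • f (NCProj.monBasis ω (e i)) := fun i => by
    have h2 := (hu i).mul (IsMonomial.monBasis N)
    have h3 := IsMonomial.monBasis (f := f) (e i)
    rw [funext (he i i.2)] at h3
    exact h2.exists_eq_smul hf h3
  choose k hk h1 using h1
  have hli : LinearIndependent K fun i : s => NCProj.monBasis ω (e i) := by
    refine (NCProj.monBasis ω).linearIndependent.comp (fun i : s => e i) fun x y hxy => ?_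
    refine Subtype.ext (ha (funext fun j => ?_))
    have := he x x.2 j
    have := he y y.2 j
    have : e x j = e y j := congrFun hxy j
    omega
  have hsum : ∑ i : s, (g i * k i) • NCProj.monBasis ω (e i) = 0 := by
    refine hf ?_
    rw [map_zero, map_sum, ← zero_mul (f (NCProj.monBasis ω N)), ← hg, Finset.sum_mul,
      ← Finset.sum_coe_sort s]
    refine Finset.sum_congr rfl fun i _ => ?_
    rw [smul_mul_assoc, h1, map_smul, smul_smul]
  have := Fintype.linearIndependent_iff.1 hli _ hsum ⟨i, hi⟩
  exact (mul_eq_zero.1 this).resolve_right (hk _)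

end Monomials

/-! ### Leading terms -/

section TwistedBasis

variable {K : Type u} [Field K] {n : ℕ} {S : Type u} [Ring S] [Algebra K S]
  (B : Module.Basis (Fin n → ℕ) K S) {γ : (Fin n → ℕ) → (Fin n → ℕ) → K}

theorem repr_mul_eq_sum (hB : ∀ a b, B a * B b = γ a b • B (a + b)) (s t : S) :
    B.repr (s * t) = ∑ a ∈ (B.repr s).support, ∑ b ∈ (B.repr t).support,
      Finsupp.single (a + b) (B.repr s a * B.repr t b * γ a b) := by
  conv_lhs => rw [← B.linearCombination_repr s, ← B.linearCombination_repr t]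
  rw [Finsupp.linearCombination_apply, Finsupp.linearCombination_apply, Finsupp.sum,
    Finsupp.sum, Finset.sum_mul_sum, map_sum]
  refine Finset.sum_congr rfl fun a _ => ?_
  rw [map_sum]
  refine Finset.sum_congr rfl fun b _ => ?_
  rw [smul_mul_smul_comm, hB, smul_smul, map_smul, Module.Basis.repr_self, Finsupp.smul_single,
    smul_eq_mul, mul_one]

theorem repr_mul_of_uniqueAdd (hB : ∀ a b, B a * B b = γ a b • B (a + b)) {s t : S}
    {a b : Fin n → ℕ} (ha : B.repr s a ≠ 0) (hb : B.repr t b ≠ 0)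
    (hu : UniqueAdd (B.repr s).support (B.repr t).support a b) :
    B.repr (s * t) (a + b) = B.repr s a * B.repr t b * γ a b := by
  classical
  rw [repr_mul_eq_sum B hB]
  simp only [Finsupp.coe_finsetSum, Finset.sum_apply]
  rw [Finset.sum_eq_single a, Finset.sum_eq_single b, Finsupp.single_eq_same]
  · intro b' hb' hne
    rw [Finsupp.single_apply, if_neg]
    exact fun h => hne (hu (Finsupp.mem_support_iff.2 ha) hb' h).2
  · exact fun h => absurd (Finsupp.mem_support_iff.2 hb) h
  · intro a' ha' hne
    refine Finset.sum_eq_zero fun b' hb' => ?_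
    rw [Finsupp.single_apply, if_neg]
    exact fun h => hne (hu ha' hb' h).1
  · exact fun h => absurd (Finsupp.mem_support_iff.2 ha) h

theorem exists_add_of_repr_mul_ne_zero (hB : ∀ a b, B a * B b = γ a b • B (a + b)) {s t : S}
    {e : Fin n → ℕ} (he : B.repr (s * t) e ≠ 0) :
    ∃ a b, B.repr s a ≠ 0 ∧ B.repr t b ≠ 0 ∧ a + b = e := by
  classical
  rw [repr_mul_eq_sum B hB] at he
  simp only [Finsupp.coe_finsetSum, Finset.sum_apply] at he
  obtain ⟨a, ha, h⟩ := Finset.exists_ne_zero_of_sum_ne_zero he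
  obtain ⟨b, hb, h⟩ := Finset.exists_ne_zero_of_sum_ne_zero h
  refine ⟨a, b, Finsupp.mem_support_iff.1 ha, Finsupp.mem_support_iff.1 hb, ?_⟩
  by_contra hne
  exact h (Finsupp.single_eq_of_ne' hne)

/-- A product that has only one term has factors with only one term. -/
theorem support_subsingleton_of_mul_eq (hγ : ∀ a b, γ a b ≠ 0)
    (hB : ∀ a b, B a * B b = γ a b • B (a + b)) {s t : S} {e : Fin n → ℕ} (h : s * t = B e)
    {a a' : Fin n → ℕ} (ha : B.repr s a ≠ 0) (ha' : B.repr s a' ≠ 0) : a = a' := by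
  classical
  by_contra hne
  have ht : B.repr t ≠ 0 := by
    intro h0
    rw [(map_eq_zero_iff _ B.repr.injective).1 h0, mul_zero] at h
    exact B.ne_zero e h.symm
  have h1 : 1 < (B.repr s).support.card := Finset.one_lt_card.2
    ⟨a, Finsupp.mem_support_iff.2 ha, a', Finsupp.mem_support_iff.2 ha', hne⟩
  have h2 : 0 < (B.repr t).support.card :=
    Finset.card_pos.2 (Finsupp.support_nonempty_iff.2 ht)
  obtain ⟨⟨a1, b1⟩, hp, ⟨a2, b2⟩, hp', hpp, hu, hu'⟩ :=
    TwoUniqueSums.uniqueAdd_of_one_lt_card (h1.trans_le (Nat.le_mul_of_pos_right _ h2))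
  rw [Finset.mem_product] at hp hp'
  have key : ∀ {a b}, a ∈ (B.repr s).support → b ∈ (B.repr t).support →
      UniqueAdd (B.repr s).support (B.repr t).support a b → a + b = e := by
    intro a b ha hb hu
    rw [Finsupp.mem_support_iff] at ha hb
    have h3 := repr_mul_of_uniqueAdd B hB ha hb hu
    rw [h, Module.Basis.repr_self, Finsupp.single_apply] at h3
    by_contra hne
    rw [if_neg (Ne.symm hne)] at h3
    exact mul_ne_zero (mul_ne_zero ha hb) (hγ a b) h3.symm
  have e1 := key hp.1 hp.2 hu
  have e2 := key hp'.1 hp'.2 hu'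
  have := hu hp'.1 hp'.2 (e2.trans e1.symm)
  exact hpp (Prod.ext this.1.symm this.2.symm)

/-- `a` is the lexicographically leading exponent of `s`. -/
def IsLeading (s : S) (a : Fin n → ℕ) : Prop :=
  B.repr s a ≠ 0 ∧ ∀ b, B.repr s b ≠ 0 → toLex b ≤ toLex a

variable {B}

theorem IsLeading.unique {s : S} {a b : Fin n → ℕ} (ha : IsLeading B s a)
    (hb : IsLeading B s b) : a = b :=
  toLex.injective (le_antisymm (hb.2 a ha.1) (ha.2 b hb.1))

theorem exists_isLeading {s : S} (hs : s ≠ 0) : ∃ a, IsLeading B s a := by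
  have h : (B.repr s).support.Nonempty :=
    Finsupp.support_nonempty_iff.2 ((map_ne_zero_iff _ B.repr.injective).2 hs)
  obtain ⟨a, ha, hmax⟩ := Finset.exists_max_image _ (toLex : (Fin n → ℕ) → _) h
  exact ⟨a, Finsupp.mem_support_iff.1 ha, fun b hb => hmax b (Finsupp.mem_support_iff.2 hb)⟩

theorem IsLeading.mul (hγ : ∀ a b, γ a b ≠ 0) (hB : ∀ a b, B a * B b = γ a b • B (a + b))
    {s t : S} {a b : Fin n → ℕ} (ha : IsLeading B s a) (hb : IsLeading B t b) :
    IsLeading B (s * t) (a + b) ∧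
      B.repr (s * t) (a + b) = B.repr s a * B.repr t b * γ a b := by
  have hu : UniqueAdd (B.repr s).support (B.repr t).support a b := by
    intro a' b' ha' hb' h
    have h1 := ha.2 a' (Finsupp.mem_support_iff.1 ha')
    have h2 := hb.2 b' (Finsupp.mem_support_iff.1 hb')
    have h3 : toLex a' + toLex b' = toLex a + toLex b := congrArg toLex h
    have h4 := (add_eq_add_iff_eq_and_eq h1 h2).1 h3
    exact ⟨toLex.injective h4.1, toLex.injective h4.2⟩
  have h := repr_mul_of_uniqueAdd B hB ha.1 hb.1 hu
  refine ⟨⟨?_, fun e he => ?_⟩, h⟩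
  · rw [h]
    exact mul_ne_zero (mul_ne_zero ha.1 hb.1) (hγ a b)
  · obtain ⟨a', b', ha', hb', rfl⟩ := exists_add_of_repr_mul_ne_zero B hB he
    exact add_le_add (ha.2 a' ha') (hb.2 b' hb')

variable (B)

open Classical in
/-- The lexicographically leading term. -/
noncomputable def leadTerm (s : S) : S :=
  if hs : ∃ a, IsLeading B s a then B.repr s hs.choose • B hs.choose else 0

variable {B}

theorem IsLeading.leadTerm_eq {s : S} {a : Fin n → ℕ} (ha : IsLeading B s a) :
    leadTerm B s = B.repr s a • B a := by
  have h : ∃ a, IsLeading B s a := ⟨a, ha⟩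
  rw [leadTerm, dif_pos h, h.choose_spec.unique ha]

theorem leadTerm_zero : leadTerm B (0 : S) = 0 := by
  rw [leadTerm, dif_neg]
  rintro ⟨a, ha, -⟩
  simp at ha

theorem isLeading_smul_basis {c : K} (hc : c ≠ 0) (a : Fin n → ℕ) :
    IsLeading B (c • B a) a := by
  classical
  constructor
  · simpa using hc
  · intro b hb
    rw [map_smul, Module.Basis.repr_self, Finsupp.smul_single, Finsupp.single_apply] at hb
    rw [show b = a by by_contra hne; exact hb (if_neg (Ne.symm hne))]

theorem leadTerm_smul_basis (c : K) (a : Fin n → ℕ) : leadTerm B (c • B a) = c • B a := by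
  by_cases hc : c = 0
  · rw [hc, zero_smul, leadTerm_zero]
  · rw [(isLeading_smul_basis hc a).leadTerm_eq]; simp

theorem leadTerm_mul (hγ : ∀ a b, γ a b ≠ 0) (hB : ∀ a b, B a * B b = γ a b • B (a + b))
    (s t : S) : leadTerm B (s * t) = leadTerm B s * leadTerm B t := by
  by_cases hs : s = 0
  · rw [hs, zero_mul, leadTerm_zero, zero_mul]
  by_cases ht : t = 0
  · rw [ht, mul_zero, leadTerm_zero, mul_zero]
  obtain ⟨a, ha⟩ := exists_isLeading (B := B) hs
  obtain ⟨b, hb⟩ := exists_isLeading (B := B) ht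
  obtain ⟨h1, h2⟩ := ha.mul hγ hB hb
  rw [ha.leadTerm_eq, hb.leadTerm_eq, h1.leadTerm_eq, h2, smul_mul_smul_comm, hB, smul_smul]

theorem leadTerm_ne_zero {s : S} (hs : s ≠ 0) : leadTerm B s ≠ 0 := by
  obtain ⟨a, ha⟩ := exists_isLeading (B := B) hs
  rw [ha.leadTerm_eq]
  exact smul_ne_zero ha.1 (B.ne_zero a)

end TwistedBasis

section LeadingTerms

variable {K : Type u} [Field K] {n : ℕ} (ω : Params K n)

theorem algebraMap_eq_smul_monBasis :
    ∃ k : K, ∀ c : K, algebraMap K (SkewPoly ω) c = (c * k) • monBasis ω 0 := by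
  obtain ⟨k, -, h⟩ := word_eq ω []
  have e : cnt ([] : List (Fin n)) = 0 := by funext; simp [cnt]
  refine ⟨k, fun c => ?_⟩
  rw [Algebra.algebraMap_eq_smul_one, mul_smul, monBasis_apply, ← e, ← h]
  simp [word]

theorem leadTerm_algebraMap (c : K) :
    leadTerm (monBasis ω) (algebraMap K (SkewPoly ω) c) = algebraMap K (SkewPoly ω) c := by
  obtain ⟨k, h⟩ := algebraMap_eq_smul_monBasis ω
  rw [h, leadTerm_smul_basis]

/-- The leading term, as a multiplicative map on `S_ω`. -/
noncomputable def leadHom : SkewPoly ω →* SkewPoly ω where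
  toFun := leadTerm (monBasis ω)
  map_one' := by simpa using leadTerm_algebraMap ω 1
  map_mul' s t := by
    obtain ⟨γ, hγ, hB⟩ := exists_monBasis_mul ω
    exact leadTerm_mul hγ hB s t

theorem leadHom_ne_zero {s : SkewPoly ω} (hs : s ≠ 0) : leadHom ω s ≠ 0 := leadTerm_ne_zero hs

theorem toFrac_injective : Function.Injective (toFrac ω) :=
  (injective_iff_map_eq_zero _).2 fun s hs => by
    by_contra h
    exact toFrac_ne_zero ω h hs

/-- The inclusion of `S_ω` into its division ring of fractions, as an algebra map. -/
noncomputable def toFracAlg : SkewPoly ω →ₐ[K] Frac ω where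
  __ := toFrac ω
  commutes' _ := rfl

theorem toFracAlg_apply (s : SkewPoly ω) : toFracAlg ω s = toFrac ω s := rfl

theorem toFracAlg_injective : Function.Injective (toFracAlg ω) := toFrac_injective ω

theorem exists_eq_inv_mul (z : Frac ω) :
    ∃ s t : SkewPoly ω, t ≠ 0 ∧ z = (toFrac ω t)⁻¹ * toFrac ω s := by
  induction z using OreLocalization.ind with | _ s t
  refine ⟨s, t, nonZeroDivisors.coe_ne_zero t, ?_⟩
  rw [eq_inv_mul_iff_mul_eq₀ (toFrac_ne_zero ω (nonZeroDivisors.coe_ne_zero t))]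
  exact OreLocalization.mul_cancel

/-- A multiplicative map from nonzero elements, valued in units. -/
noncomputable def unitsOfNonZero {M : Type*} [MonoidWithZero M] {D : Type*} [DivisionRing D]
    (f : M →* D) (hf : ∀ s : M⁰, f s ≠ 0) : M⁰ →* Dˣ where
  toFun s := Units.mk0 (f s) (hf s)
  map_one' := Units.ext (by simp)
  map_mul' s t := Units.ext (by simp)

/-- The leading term of an element of `S_ω`, in the division ring of fractions. -/
noncomputable def toFracLeadHom : SkewPoly ω →* Frac ω :=
  (toFrac ω : SkewPoly ω →* Frac ω).comp (leadHom ω)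

theorem toFracLeadHom_ne_zero (s : (SkewPoly ω)⁰) : toFracLeadHom ω s ≠ 0 :=
  toFrac_ne_zero ω (leadHom_ne_zero ω (nonZeroDivisors.coe_ne_zero s))

/-- The leading term, as a multiplicative map on the division ring of fractions. -/
noncomputable def fracLeadHom : Frac ω →* Frac ω :=
  OreLocalization.universalMulHom (toFracLeadHom ω)
    (unitsOfNonZero (M := SkewPoly ω) (D := Frac ω) (toFracLeadHom ω) (toFracLeadHom_ne_zero ω)) (by intro s; rfl)

theorem fracLeadHom_toFrac (s : SkewPoly ω) :
    fracLeadHom ω (toFrac ω s) = toFrac ω (leadHom ω s) := by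
  change fracLeadHom ω (OreLocalization.numeratorHom s) = toFracLeadHom ω s
  exact OreLocalization.universalMulHom_commutes (toFracLeadHom ω)
    (unitsOfNonZero (M := SkewPoly ω) (D := Frac ω) (toFracLeadHom ω) (toFracLeadHom_ne_zero ω)) _

theorem sum_cnt (l : List (Fin n)) : ∑ i, cnt l i = l.length := by
  simpa [cnt] using Multiset.sum_count_eq_card (s := Finset.univ) (m := (l : Multiset (Fin n)))
    (fun _ _ => Finset.mem_univ _)

theorem sum_eq_of_mem_homog {d : ℕ} {f : SkewPoly ω} (hf : f ∈ homog ω d) {a : Fin n → ℕ}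
    (ha : (monBasis ω).repr f a ≠ 0) : ∑ i, a i = d := by
  classical
  have h := homog_le ω d hf
  have h2 : (monBasis ω).repr f ∈ Finsupp.supported K K {a : Fin n → ℕ | ∑ i, a i = d} := by
    clear ha hf
    induction h using Submodule.span_induction with
    | mem x hx =>
      obtain ⟨l, hl, rfl⟩ := hx
      obtain ⟨c, -, h⟩ := word_eq ω l
      rw [h, ← monBasis_apply, map_smul, Module.Basis.repr_self]
      refine Submodule.smul_mem _ _ (Finsupp.single_mem_supported K _ ?_)
      exact (sum_cnt l).trans hl
    | zero => simp
    | add x y _ _ hx hy => rw [map_add]; exact Submodule.add_mem _ hx hy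
    | smul r x _ hx => rw [map_smul]; exact Submodule.smul_mem _ _ hx
  exact (Finsupp.mem_supported K _).1 h2 (Finsupp.mem_support_iff.2 ha)

/-- The leading term of a homogeneous fraction is a monomial of degree zero. -/
theorem isMonomial_fracLeadHom {y : Frac ω} (hy : y ∈ functionRing ω) (hy0 : y ≠ 0) :
    ∃ a : Fin n → ℤ, ∑ i, a i = 0 ∧ IsMonomial (toFracAlg ω) a (fracLeadHom ω y) := by
  obtain ⟨d, f, hf, g, hg, hg0, rfl⟩ := hy
  have hf0 : f ≠ 0 := by
    rintro rfl
    rw [map_zero, zero_mul] at hy0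
    exact hy0 rfl
  obtain ⟨a, ha⟩ := exists_isLeading (B := monBasis ω) hf0
  obtain ⟨b, hb⟩ := exists_isLeading (B := monBasis ω) hg0
  refine ⟨(fun i => (a i : ℤ)) + -(fun i => (b i : ℤ)), ?_, ?_⟩
  · have h1 := sum_eq_of_mem_homog ω hf ha.1
    have h2 := sum_eq_of_mem_homog ω hg hb.1
    simp only [Pi.add_apply, Pi.neg_apply, Finset.sum_add_distrib, Finset.sum_neg_distrib]
    rw [← Nat.cast_sum, ← Nat.cast_sum, h1, h2, add_neg_cancel]
  · have h1 := (IsMonomial.monBasis (D := Frac ω) (f := toFracAlg ω) a).smul ha.1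
    have h2 := (IsMonomial.monBasis (D := Frac ω) (f := toFracAlg ω) b).smul hb.1
    rw [← map_smul, toFracAlg_apply, ← ha.leadTerm_eq] at h1
    rw [← map_smul, toFracAlg_apply, ← hb.leadTerm_eq] at h2
    have h3 : fracLeadHom ω (toFrac ω f * (toFrac ω g)⁻¹) =
        toFrac ω (leadTerm (monBasis ω) f) * (toFrac ω (leadTerm (monBasis ω) g))⁻¹ := by
      rw [eq_mul_inv_iff_mul_eq₀ (toFrac_ne_zero ω (leadTerm_ne_zero hg0))]
      change _ * toFrac ω (leadHom ω g) = toFrac ω (leadHom ω f)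
      rw [← fracLeadHom_toFrac, ← fracLeadHom_toFrac, ← map_mul,
        inv_mul_cancel_right₀ (toFrac_ne_zero ω hg0)]
    rw [h3]
    exact h1.mul h2.inv

theorem fracLeadHom_algebraMap (c : K) :
    fracLeadHom ω (algebraMap K _ c) = algebraMap K _ c :=
  (fracLeadHom_toFrac ω _).trans (congrArg _ (leadTerm_algebraMap ω c))

/-- Elements of the function ring which `q`-commute have leading exponents on which the
bicharacter takes the same values. -/
theorem exists_chi_eq {ι : Type*} {c : ι → ι → K} {y : ι → Frac ω}
    (hy : ∀ i, y i ∈ functionRing ω) (hy0 : ∀ i, y i ≠ 0)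
    (h : ∀ i j, y j * y i = c i j • (y i * y j)) :
    ∃ a : ι → Fin n → ℤ, (∀ i, ∑ k, a i k = 0) ∧ ∀ i j, c i j = chi ω (a i) (a j) := by
  choose a ha0 ha using fun i => isMonomial_fracLeadHom ω (hy i) (hy0 i)
  refine ⟨a, ha0, fun i j => ?_⟩
  have h1 := (ha i).comm (toFracAlg_injective ω) (ha j)
  have h2 := congrArg (fracLeadHom ω) (h i j)
  rw [Algebra.smul_def (A := Frac ω), map_mul, map_mul, map_mul, fracLeadHom_algebraMap,
    ← Algebra.smul_def (A := Frac ω),    h1] at h2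
  have hne : fracLeadHom ω (y i) * fracLeadHom ω (y j) ≠ 0 :=
    mul_ne_zero ((ha i).ne_zero (toFracAlg_injective ω)) ((ha j).ne_zero (toFracAlg_injective ω))
  exact (smul_left_injective (M := Frac ω) K hne h2).symm

end LeadingTerms

/-! ### Integral isometries of a nondegenerate bicharacter are invertible -/

section Isometry

/-- An integral isometry `M` of a nondegenerate pairing is invertible, because the reversed
characteristic polynomial of `M` annihilates `M`. -/
theorem isUnit_of_isometry {m : ℕ} {V : Type*} [AddCommGroup V]
    (Λ : (Fin m → ℤ) →ₗ[ℤ] (Fin m → ℤ) →ₗ[ℤ] V) (hΛ : ∀ y, (∀ x, Λ x y = 0) → y = 0)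
    (M : Matrix (Fin m) (Fin m) ℤ)
    (hM : ∀ x y, Λ (M.mulVec x) (M.mulVec y) = Λ x y) : IsUnit M := by
  have hpow : ∀ (k : ℕ) (x y), Λ ((M ^ k).mulVec x) ((M ^ k).mulVec y) = Λ x y := by
    intro k
    induction k with
    | zero => simp
    | succ k ih =>
      intro x y
      rw [pow_succ', ← Matrix.mulVec_mulVec, ← Matrix.mulVec_mulVec, hM, ih]
  have hdeg : M.charpoly.natDegree = m := by
    rw [Matrix.charpoly_natDegree_eq_dim, Fintype.card_fin]
  have hCH := M.aeval_self_charpoly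
  rw [Polynomial.aeval_eq_sum_range, hdeg] at hCH
  have hrev : ∑ k ∈ Finset.range (m + 1), M.charpoly.coeff k • M ^ (m - k) = 0 := by
    refine Matrix.mulVec_injective (funext fun y => ?_)
    rw [Matrix.zero_mulVec]
    refine hΛ _ fun x => ?_
    have h0 := congrArg (fun N => Λ (N.mulVec x) ((M ^ m).mulVec y)) hCH
    simp only [Matrix.zero_mulVec, map_zero, LinearMap.zero_apply, Matrix.sum_mulVec, map_sum,
      LinearMap.sum_apply] at h0 ⊢
    rw [← h0]
    refine Finset.sum_congr rfl fun k hk => ?_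
    have hk' : M ^ m = M ^ k * M ^ (m - k) := by
      rw [← pow_add, Nat.add_sub_cancel' (Nat.lt_succ_iff.1 (Finset.mem_range.1 hk))]
    rw [Matrix.smul_mulVec, Matrix.smul_mulVec, map_smul, map_smul, LinearMap.smul_apply]
    rw [hk', ← Matrix.mulVec_mulVec, hpow]
  have hlead : M.charpoly.coeff m = 1 := by
    have := M.charpoly_monic
    rwa [Polynomial.Monic, Polynomial.leadingCoeff, hdeg] at this
  rw [Finset.sum_range_succ, hlead, one_smul, Nat.sub_self, pow_zero] at hrev
  have hr : M * -(∑ k ∈ Finset.range m, M.charpoly.coeff k • M ^ (m - k - 1)) = 1 := by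
    rw [mul_neg, Finset.mul_sum, neg_eq_iff_eq_neg, eq_neg_iff_add_eq_zero, ← hrev]
    congr 1
    refine Finset.sum_congr rfl fun k hk => ?_
    rw [mul_smul_comm, ← pow_succ']
    congr 2
    have := Finset.mem_range.1 hk
    omega
  exact IsUnit.of_mul_eq_one _ hr

end Isometry

section Congruence

variable {K : Type u} [Field K] {m : ℕ}

theorem chi_mulVec (q : Params K m) (A : Matrix (Fin m) (Fin m) ℤ) (i j : Fin m) :
    chi q (A.mulVec (Pi.single i 1)) (A.mulVec (Pi.single j 1)) =
      ∏ k, ∏ l, q.val k l ^ (A k i * A l j) := by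
  rw [chi_eq_prod]
  simp

theorem pairing_mulVec {q q' : Params K m} {A : Matrix (Fin m) (Fin m) ℤ}
    (h : ∀ i j, q'.val i j = ∏ k, ∏ l, q.val k l ^ (A k i * A l j)) (x y : Fin m → ℤ) :
    pairing q (A.mulVec x) (A.mulVec y) = pairing q' x y := by
  have : (pairing q).compl₁₂ A.mulVecLin A.mulVecLin = pairing q' := by
    refine (Pi.basisFun ℤ (Fin m)).ext fun i => (Pi.basisFun ℤ (Fin m)).ext fun j => ?_
    rw [Pi.basisFun_apply, Pi.basisFun_apply, LinearMap.compl₁₂_apply, Matrix.mulVecLin_apply,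
      Matrix.mulVecLin_apply, ← chi_eq_iff, chi_mulVec, chi_single, h]
  exact congrArg (fun Λ => Λ x y) this

theorem isUnit_of_mutual_congruence {q q' : Params K m}
    (hq : ∀ y, (∀ x, pairing q x y = 0) → y = 0) {A B : Matrix (Fin m) (Fin m) ℤ}
    (hA : ∀ i j, q'.val i j = ∏ k, ∏ l, q.val k l ^ (A k i * A l j))
    (hB : ∀ i j, q.val i j = ∏ k, ∏ l, q'.val k l ^ (B k i * B l j)) : IsUnit A := by
  have h := isUnit_of_isometry (pairing q) hq (A * B) fun x y => by
    rw [← Matrix.mulVec_mulVec, ← Matrix.mulVec_mulVec, pairing_mulVec hA, pairing_mulVec hB]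
  rw [Matrix.isUnit_iff_isUnit_det, Matrix.det_mul] at h
  exact (Matrix.isUnit_iff_isUnit_det A).2 (isUnit_of_mul_isUnit_left h)

end Congruence

/-! ### Exponents of the monomials in a subalgebra -/

section Exponents

variable {K : Type u} [Field K] {n : ℕ} {ω : Params K n}
  {D : Type*} [DivisionRing D] [Algebra K D] {f : SkewPoly ω →ₐ[K] D}

variable (f) in
/-- The exponents `a` such that the Laurent monomials with exponents `a` and `-a` lie in `R`,
up to scalars. -/
def exponents (R : Subalgebra K D) : AddSubgroup (Fin n → ℤ) where
  carrier := {a | (∃ u ∈ R, IsMonomial f a u) ∧ ∃ u ∈ R, IsMonomial f (-a) u}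
  zero_mem' := ⟨⟨1, R.one_mem, IsMonomial.one⟩, 1, R.one_mem, by
    rw [neg_zero]; exact IsMonomial.one⟩
  add_mem' := by
    rintro a b ⟨⟨u, hu, hau⟩, u', hu', hau'⟩ ⟨⟨v, hv, hbv⟩, v', hv', hbv'⟩
    refine ⟨⟨u * v, R.mul_mem hu hv, hau.mul hbv⟩, u' * v', R.mul_mem hu' hv', ?_⟩
    rw [neg_add]
    exact hau'.mul hbv'
  neg_mem' := by
    rintro a ⟨h, h'⟩
    exact ⟨h', by rwa [neg_neg]⟩

theorem IsMonomial.mem_of_mem_exponents (hf : Function.Injective f) {R : Subalgebra K D}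
    {a : Fin n → ℤ} (ha : a ∈ exponents f R) {u : D} (hu : IsMonomial f a u) : u ∈ R := by
  obtain ⟨⟨v, hv, hav⟩, -⟩ := ha
  obtain ⟨k, -, rfl⟩ := hu.exists_eq_smul hf hav
  exact R.smul_mem hv k

theorem map_mem_of_map_single_mem {m : ℕ} (H : AddSubgroup (Fin n → ℤ))
    (φ : (Fin m → ℤ) →ₗ[ℤ] (Fin n → ℤ)) (h : ∀ i, φ (Pi.single i 1) ∈ H) (b : Fin m → ℤ) :
    φ b ∈ H := by
  have : φ b = ∑ i, b i • φ (Pi.single i 1) := by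
    conv_lhs => rw [pi_eq_sum_univ' b, map_sum]
    refine Finset.sum_congr rfl fun i _ => ?_
    rw [map_smul]
  rw [this]
  exact H.sum_mem fun i _ => H.zsmul_mem (h i) _

theorem exists_isMonomial (f : SkewPoly ω →ₐ[K] D) (a : Fin n → ℤ) : ∃ u, IsMonomial f a u := by
  have h := (IsMonomial.monBasis (f := f) fun i => (a i).toNat).mul
    (IsMonomial.monBasis (f := f) fun i => (-a i).toNat).inv
  have ha : (fun i => ((a i).toNat : ℤ)) + -(fun i => ((-a i).toNat : ℤ)) = a := by
    funext i
    simp only [Pi.add_apply, Pi.neg_apply]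
    omega
  rw [ha] at h
  exact ⟨_, h⟩

end Exponents

/-! ### The bicharacter of a simple quantum torus is nondegenerate -/

section Torus

variable {K : Type u} [Field K] {n : ℕ} {q : Params K n}
  {D : Type*} [DivisionRing D] [Algebra K D] {f : SkewPoly q →ₐ[K] D}

/-- The image of a generator of the quantum torus. -/
noncomputable def torusGen (f : SkewPoly q →ₐ[K] D) (p : Fin n × Bool) : D :=
  if p.2 then f (gen q p.1) else (f (gen q p.1))⁻¹

/-- The map from the quantum torus to a division ring that contains `S_q`. -/
noncomputable def torusHom (hf : Function.Injective f) : QuantumTorus q →ₐ[K] D :=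
  RingQuot.liftAlgHom K ⟨FreeAlgebra.lift K (torusGen f), by
    have h0 : ∀ i, f (gen q i) ≠ 0 := fun i => map_ne_zero_of hf (gen_ne_zero q i)
    rintro _ _ (i | i | ⟨i, j⟩)
    · simp [torusGen, h0 i]
    · simp [torusGen, h0 i]
    · simp only [map_mul, map_smul, FreeAlgebra.lift_ι_apply, torusGen, if_true]
      rw [← map_mul, gen_mul_gen, map_smul, map_mul]⟩

theorem torusHom_mk (hf : Function.Injective f) (p : Fin n × Bool) :
    torusHom hf (RingQuot.mkAlgHom K (TorusRel q) (FreeAlgebra.ι K p)) = torusGen f p := by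
  rw [torusHom, RingQuot.liftAlgHom_mkAlgHom_apply, FreeAlgebra.lift_ι_apply]

theorem mem_exponents_torusHom (hf : Function.Injective f) (a : Fin n → ℤ) :
    a ∈ exponents f (torusHom hf).range := by
  refine map_mem_of_map_single_mem _ LinearMap.id (fun i => ?_) a
  refine And.intro ⟨_, ⟨_, torusHom_mk hf (i, true)⟩, ?_⟩
    ⟨_, ⟨_, torusHom_mk hf (i, false)⟩, ?_⟩
  · simpa [torusGen] using IsMonomial.gen (f := f) i
  · simpa [torusGen] using (IsMonomial.gen (f := f) i).inv

theorem torusHom_mem_span (hf : Function.Injective f) (t : QuantumTorus q) :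
    torusHom hf t ∈ Submodule.span K {u | ∃ a, IsMonomial f a u} := by
  obtain ⟨p, rfl⟩ := RingQuot.mkAlgHom_surjective K (TorusRel q) t
  induction p using FreeAlgebra.induction with
  | grade0 r =>
    rw [AlgHom.commutes, AlgHom.commutes, Algebra.algebraMap_eq_smul_one]
    exact Submodule.smul_mem _ _ (Submodule.subset_span ⟨0, IsMonomial.one⟩)
  | grade1 x =>
    rw [torusHom_mk]
    obtain ⟨i, b⟩ := x
    cases b
    · exact Submodule.subset_span ⟨_, by simpa [torusGen] using (IsMonomial.gen (f := f) i).inv⟩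
    · exact Submodule.subset_span ⟨_, by simpa [torusGen] using IsMonomial.gen (f := f) i⟩
  | mul a b ha hb =>
    rw [map_mul, map_mul]
    have h : Submodule.span K {u | ∃ a, IsMonomial f a u} *
        Submodule.span K {u | ∃ a, IsMonomial f a u} ≤
        Submodule.span K {u | ∃ a, IsMonomial f a u} := by
      rw [Submodule.span_mul_span, Submodule.span_le]
      rintro _ ⟨u, ⟨a, hu⟩, v, ⟨b, hv⟩, rfl⟩
      exact Submodule.subset_span ⟨a + b, hu.mul hv⟩
    exact h (Submodule.mul_mem_mul ha hb)
  | add a b ha hb => rw [map_add, map_add]; exact Submodule.add_mem _ ha hb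

/-- Laurent polynomials become polynomials after multiplication by a monomial. -/
theorem exists_mul_eq_of_mem_span (hf : Function.Injective f) {r : D}
    (hr : r ∈ Submodule.span K {u | ∃ a, IsMonomial f a u}) :
    ∃ (N : Fin n → ℕ) (s : SkewPoly q), r * f (monBasis q N) = f s := by
  induction hr using Submodule.span_induction with
  | mem x hx =>
    obtain ⟨a, ha⟩ := hx
    obtain ⟨c, d, k, -, -, h⟩ := ha.exists_mul_eq hf
    exact ⟨d, k • monBasis q c, by rw [h, map_smul]⟩
  | zero => exact ⟨0, 0, by simp⟩
  | add x y _ _ hx hy =>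
    obtain ⟨N, s, hx⟩ := hx
    obtain ⟨M, t, hy⟩ := hy
    obtain ⟨γ, hγ, hB⟩ := exists_monBasis_mul q
    refine ⟨N + M, (γ N M)⁻¹ • (s * monBasis q M) + (γ M N)⁻¹ • (t * monBasis q N), ?_⟩
    have h1 : monBasis q (N + M) = (γ N M)⁻¹ • (monBasis q N * monBasis q M) := by
      rw [hB, inv_smul_smul₀ (hγ _ _)]
    have h2 : monBasis q (N + M) = (γ M N)⁻¹ • (monBasis q M * monBasis q N) := by
      rw [hB, inv_smul_smul₀ (hγ _ _), add_comm]
    rw [add_mul, map_add f]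
    congr 1
    · rw [h1, map_smul, map_smul, map_mul, map_mul, mul_smul_comm, ← mul_assoc, hx]
    · rw [h2, map_smul, map_smul, map_mul, map_mul, mul_smul_comm, ← mul_assoc, hy]
  | smul c x _ hx =>
    obtain ⟨N, s, hx⟩ := hx
    exact ⟨N, c • s, by rw [smul_mul_assoc, hx, map_smul]⟩

theorem pairing_nondegenerate_of_injective (hf : Function.Injective f) (hq : IsGeneric q)
    (y : Fin n → ℤ) (hy : ∀ x, pairing q x y = 0) : y = 0 := by
  have : IsSimpleRing (QuantumTorus q) := hq
  have hinj : Function.Injective (torusHom hf) := (torusHom hf).toRingHom.injective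
  obtain ⟨⟨_, ⟨t, rfl⟩, ht⟩, -⟩ := mem_exponents_torusHom hf y
  change IsMonomial f y (torusHom hf t) at ht
  have hcomm : ∀ {a u}, IsMonomial f a u → torusHom hf t * u = u * torusHom hf t := by
    intro a u hu
    rw [hu.comm hf ht, chi, hy]
    simp
  have hcentral : t - 1 ∈ Subring.center (QuantumTorus q) := by
    refine Subring.sub_mem _ (Subring.mem_center_iff.2 fun r => hinj ?_) (Subring.one_mem _)
    rw [map_mul, map_mul]
    have hr := torusHom_mem_span hf r
    generalize torusHom hf r = r' at hr ⊢
    induction hr using Submodule.span_induction with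
    | mem x hx => exact (hcomm hx.choose_spec).symm
    | zero => simp
    | add x y _ _ hx hy => rw [add_mul, mul_add, hx, hy]
    | smul c x _ hx => rw [smul_mul_assoc, mul_smul_comm, hx]
  obtain ⟨c, d, k, hk, hcd, h⟩ := ht.exists_mul_eq hf
  suffices hsuff : c = d by funext i; simp [hcd, hsuff]
  by_contra hne
  have hz : t - 1 ≠ 0 := by
    intro h0
    rw [sub_eq_zero.1 h0, map_one, one_mul, ← map_smul] at h
    have h1 := congrArg (fun s => (monBasis q).repr s d) (hf h)
    simp [hne] at h1
  obtain ⟨⟨w, hwc⟩, hw⟩ := (IsSimpleRing.isField_center (QuantumTorus q)).mul_inv_cancel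
    (a := ⟨t - 1, hcentral⟩) (fun h0 => hz (congrArg Subtype.val h0))
  have hw' : (t - 1) * w = 1 := congrArg Subtype.val hw
  have hw2 := congrArg (torusHom hf) hw'
  rw [map_mul, map_sub, map_one] at hw2
  obtain ⟨N, s, hs⟩ := exists_mul_eq_of_mem_span hf (torusHom_mem_span hf w)
  obtain ⟨γ, hγ, hB⟩ := exists_monBasis_mul q
  have h1 : (k • monBasis q c - monBasis q d) * ((γ d N)⁻¹ • s) = monBasis q (d + N) := by
    have : monBasis q (d + N) = (γ d N)⁻¹ • (monBasis q d * monBasis q N) := by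
      rw [hB, inv_smul_smul₀ (hγ _ _)]
    rw [this, mul_smul_comm]
    congr 1
    apply hf
    rw [map_mul, map_mul, map_sub, map_smul, ← h, ← hs, hcomm (IsMonomial.monBasis d),
      ← mul_sub_one, mul_assoc, ← mul_assoc _ _ (f (monBasis q N)), hw2, one_mul]
  refine hne (support_subsingleton_of_mul_eq (monBasis q) hγ hB h1 ?_ ?_)
  · simpa [Finsupp.single_apply, Ne.symm hne] using hk
  · simp [hne]

theorem IsGeneric.pairing_nondegenerate (hq : IsGeneric q) (y : Fin n → ℤ)
    (hy : ∀ x, pairing q x y = 0) : y = 0 :=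
  pairing_nondegenerate_of_injective (D := Frac q) (toFracAlg_injective q) hq y hy

end Torus

/-! ### Exponents of degree zero -/

section Degree

variable {K : Type u} [Field K] {m : ℕ} (ω : Params K (m + 1))

/-- The isomorphism of `ℤ ^ m` with the vectors in `ℤ ^ (m + 1)` with sum zero. -/
def degZero (m : ℕ) : (Fin m → ℤ) →ₗ[ℤ] (Fin (m + 1) → ℤ) where
  toFun b := Fin.cons (-∑ i, b i) b
  map_add' b b' := by
    funext i
    refine Fin.cases ?_ (fun i => ?_) i
    · simp [Finset.sum_add_distrib, add_comm]
    · simp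
  map_smul' c b := by
    funext i
    refine Fin.cases ?_ (fun i => ?_) i
    · simp [Finset.mul_sum]
    · simp

theorem degZero_zero (b : Fin m → ℤ) : degZero m b 0 = -∑ i, b i := rfl

theorem degZero_succ (b : Fin m → ℤ) (i : Fin m) : degZero m b i.succ = b i := rfl

theorem sum_degZero (b : Fin m → ℤ) : ∑ i, degZero m b i = 0 := by
  rw [Fin.sum_univ_succ]
  simp [degZero_zero, degZero_succ]

theorem degZero_injective : Function.Injective (degZero m) := fun _ _ h =>
  funext fun i => congrFun h i.succ

theorem degZero_tail {a : Fin (m + 1) → ℤ} (ha : ∑ i, a i = 0) :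
    degZero m (fun i => a i.succ) = a := by
  rw [Fin.sum_univ_succ] at ha
  funext i
  refine Fin.cases ?_ (fun i => ?_) i
  · rw [degZero_zero]; omega
  · rw [degZero_succ]

theorem degZero_single (i : Fin m) :
    degZero m (Pi.single i 1) = Pi.single i.succ 1 + -Pi.single 0 1 := by
  funext j
  refine Fin.cases ?_ (fun j => ?_) j
  · simp [degZero_zero]
  · simp [degZero_succ, Pi.single_apply]

theorem pairing_degZero (b b' : Fin m → ℤ) :
    pairing ω (degZero m b) (degZero m b') = pairing (cycParams ω) b b' := by
  have : (pairing ω).compl₁₂ (degZero m) (degZero m) = pairing (cycParams ω) := by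
    refine (Pi.basisFun ℤ (Fin m)).ext fun i => (Pi.basisFun ℤ (Fin m)).ext fun j => ?_
    rw [Pi.basisFun_apply, Pi.basisFun_apply, LinearMap.compl₁₂_apply, ← chi_eq_iff, chi_single,
      degZero_single, degZero_single]
    simp only [chi_add_left, chi_add_right, chi_neg_left, chi_neg_right, chi_single, inv_one,
      ω.diag, mul_one]
    rw [inv_eq_of_mul_eq_one_right (ω.mul_swap i.succ 0),
      inv_eq_of_mul_eq_one_right (ω.mul_swap 0 j.succ)]
    simp only [cycParams, cyc]
    ring
  exact congrArg (fun Λ => Λ b b') this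

theorem chi_degZero (b b' : Fin m → ℤ) :
    chi ω (degZero m b) (degZero m b') = chi (cycParams ω) b b' :=
  (chi_eq_iff ..).2 (pairing_degZero ω b b')

end Degree

/-! ### The function ring is the division ring of fractions of a skew polynomial algebra -/

section FunctionRing

variable {K : Type u} [Field K] {n : ℕ} {ω : Params K n}

theorem monBasis_mem_homog (a : Fin n → ℕ) : monBasis ω a ∈ homog ω (∑ i, a i) := by
  have h : (mon a).length = ∑ i, a i := by rw [← sum_cnt, cnt_mon]
  rw [monBasis_apply, ← h]
  exact word_mem_homog ω _

theorem inv_mem_functionRing {z : Frac ω} (hz : z ∈ functionRing ω) : z⁻¹ ∈ functionRing ω := by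
  obtain ⟨d, f, hf, g, hg, hg0, rfl⟩ := hz
  by_cases hf0 : f = 0
  · rw [hf0, map_zero, zero_mul, inv_zero]
    exact Subalgebra.zero_mem _
  · exact ⟨d, g, hg, f, hf, hf0, by rw [mul_inv_rev, inv_inv]⟩

theorem IsMonomial.mem_functionRing {a : Fin n → ℤ} {u : Frac ω}
    (hu : IsMonomial (toFracAlg ω) a u) (ha : ∑ i, a i = 0) : u ∈ functionRing ω := by
  obtain ⟨c, d, k, -, h, hcd⟩ := hu.exists_mul_eq (toFracAlg_injective ω)
  have hd : ∑ i, c i = ∑ i, d i := by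
    simp only [h, Finset.sum_sub_distrib] at ha
    have := sub_eq_zero.1 ha
    exact_mod_cast this
  refine ⟨∑ i, d i, k • NCProj.monBasis ω c, ?_, NCProj.monBasis ω d, monBasis_mem_homog d,
    (NCProj.monBasis ω).ne_zero d, ?_⟩
  · rw [← hd]
    exact Submodule.smul_mem _ _ (monBasis_mem_homog c)
  · rw [eq_mul_inv_iff_mul_eq₀ (toFrac_ne_zero ω ((NCProj.monBasis ω).ne_zero d))]
    rw [← map_smul] at hcd
    exact hcd

end FunctionRing

section SkewHom

variable {K : Type u} [Field K] {m : ℕ} {D : Type u} [Ring D] [Algebra K D]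

/-- The universal property of the skew polynomial algebra. -/
noncomputable def skewHom (q : Params K m) (z : Fin m → D)
    (hz : ∀ i j, z j * z i = q.val i j • (z i * z j)) : SkewPoly q →ₐ[K] D :=
  RingQuot.liftAlgHom K ⟨FreeAlgebra.lift K z, by
    rintro _ _ ⟨i, j⟩
    simp only [map_mul, map_smul, FreeAlgebra.lift_ι_apply, hz i j]⟩

theorem skewHom_gen (q : Params K m) (z : Fin m → D)
    (hz : ∀ i j, z j * z i = q.val i j • (z i * z j)) (i : Fin m) :
    skewHom q z hz (gen q i) = z i := by
  rw [skewHom, gen, RingQuot.liftAlgHom_mkAlgHom_apply, FreeAlgebra.lift_ι_apply]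

theorem injective_of_linearIndependent {ι S : Type*} [Ring S] [Algebra K S]
    (B : Module.Basis ι K S) (ψ : S →ₐ[K] D) (h : LinearIndependent K fun i => ψ (B i)) :
    Function.Injective ψ := by
  refine (injective_iff_map_eq_zero ψ).2 fun s hs => ?_
  rw [← B.linearCombination_repr s, ← AlgHom.toLinearMap_apply,
    Finsupp.apply_linearCombination] at hs
  have := linearIndependent_iff.1 h (B.repr s) hs
  exact (map_eq_zero_iff _ B.repr.injective).1 this

end SkewHom

section Extend

variable {K : Type u} [Field K] {m : ℕ} {q : Params K m} {D : Type u} [DivisionRing D]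
  [Algebra K D]

/-- Injective maps from `S_q` to division rings extend to the division ring of fractions. -/
theorem exists_frac_extension (ψ : SkewPoly q →ₐ[K] D) (hψ : Function.Injective ψ) :
    ∃ Ψ : Frac q →ₐ[K] D, ∀ s, Ψ (toFrac q s) = ψ s := by
  have hne : ∀ s : (SkewPoly q)⁰, (ψ : SkewPoly q →* D) s ≠ 0 := fun s =>
    map_ne_zero_of hψ (nonZeroDivisors.coe_ne_zero s)
  let U := unitsOfNonZero (M := SkewPoly q) (D := D) (ψ : SkewPoly q →* D) hne
  have hU : ∀ s : (SkewPoly q)⁰, (ψ : SkewPoly q →+* D) s = U s := fun s => rfl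
  let Φ : Frac q →+* D := OreLocalization.universalHom (ψ : SkewPoly q →+* D) U hU
  have hΦ : ∀ s, Φ (toFrac q s) = ψ s := fun s =>
    OreLocalization.universalHom_commutes (ψ : SkewPoly q →+* D) U hU
  exact ⟨{ Φ with commutes' := fun c => (hΦ _).trans (ψ.commutes c) }, hΦ⟩

theorem algHom_injective {E : Type*} [DivisionRing E] [Algebra K E] (Ψ : D →ₐ[K] E) :
    Function.Injective Ψ := (Ψ : D →+* E).injective

end Extend

section Main

variable {K : Type u} [Field K] {m : ℕ}

theorem nonempty_frac_equiv_functionRing (ω : Params K (m + 1)) (q' : Params K m)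
    (A : Matrix.GeneralLinearGroup (Fin m) ℤ)
    (hA : ∀ i j, q'.val i j = ∏ k, ∏ l, (cycParams ω).val k l ^ (A.val k i * A.val l j)) :
    Nonempty (Frac q' ≃ₐ[K] functionRing ω) := by
  have hf := toFracAlg_injective ω
  let w : (Fin m → ℤ) →ₗ[ℤ] (Fin (m + 1) → ℤ) := (degZero m).comp A.val.mulVecLin
  have hAinj : Function.Injective A.val.mulVec :=
    Matrix.mulVec_injective_of_isUnit A.isUnit
  have hw : Function.Injective w := degZero_injective.comp hAinj
  choose z hz using fun i : Fin m => exists_isMonomial (D := Frac ω) (toFracAlg ω)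
    (w (Pi.single i 1))
  have hcomm : ∀ i j, z j * z i = q'.val i j • (z i * z j) := by
    intro i j
    rw [(hz i).comm hf (hz j), hA, ← chi_mulVec, ← chi_degZero]
    rfl
  let ψ := skewHom q' z hcomm
  have hψword : ∀ l, IsMonomial (toFracAlg ω) (w fun i => (cnt l i : ℤ)) (ψ (word q' l)) := by
    intro l
    induction l with
    | nil =>
      convert IsMonomial.one (D := Frac ω) (f := toFracAlg ω) using 1
      · rw [← map_zero w]; congr 1
      · simp [word]
    | cons x l ih =>
      convert (hz x).mul ih using 1
      · rw [← map_add]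
        congr 1
        funext k
        by_cases hk : k = x
        · subst hk; simp [cnt, add_comm]
        · simp [cnt, hk, List.count_cons_of_ne (Ne.symm hk)]
      · have : word q' (x :: l) = gen q' x * word q' l := by simp [word]
        rw [this, map_mul, skewHom_gen]
  have hψ : Function.Injective ψ := by
    refine injective_of_linearIndependent (D := Frac ω) (monBasis q') ψ
      (IsMonomial.linearIndependent (D := Frac ω) (f := toFracAlg ω) hf
        (a := fun a : Fin m → ℕ => w fun i => (a i : ℤ)) (fun a => ?_) fun a b h => ?_)
    · have := hψword (mon a)
      rwa [cnt_mon, ← monBasis_apply] at this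
    · funext i
      exact_mod_cast congrFun (hw h) i
  obtain ⟨Ψ, hΨ⟩ := exists_frac_extension (D := Frac ω) ψ hψ
  have hΨinj : Function.Injective Ψ := algHom_injective (D := Frac q') (E := Frac ω) Ψ
  have hΨgen : ∀ i, Ψ (toFrac q' (gen q' i)) = z i := fun i => by rw [hΨ, skewHom_gen]
  have hexp : ∀ a : Fin (m + 1) → ℤ, ∑ i, a i = 0 →
      a ∈ exponents (D := Frac ω) (toFracAlg ω) Ψ.range := by
    intro a ha
    have h1 : w ((A⁻¹).val.mulVec fun i => a i.succ) = a := by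
      rw [LinearMap.comp_apply, Matrix.mulVecLin_apply, Matrix.mulVec_mulVec, ← Units.val_mul,
        mul_inv_cancel, Units.val_one, Matrix.one_mulVec, degZero_tail ha]
    rw [← h1]
    refine map_mem_of_map_single_mem _ w (fun i => ?_) _
    refine And.intro ⟨z i, ⟨_, hΨgen i⟩, hz i⟩
      ⟨(z i)⁻¹, ⟨(toFrac q' (gen q' i))⁻¹, ?_⟩, (hz i).inv⟩
    change Ψ _ = _
    rw [map_inv₀, hΨgen]
  have hrange : Ψ.range = functionRing ω := by
    apply le_antisymm
    · rintro _ ⟨y, rfl⟩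
      obtain ⟨s, t, -, rfl⟩ := exists_eq_inv_mul q' y
      have hmem : ∀ s, ψ s ∈ functionRing ω := by
        intro s
        have h : s ∈ Submodule.span K (Set.range (word q')) := by rw [word_span]; trivial
        induction h using Submodule.span_induction with
        | mem x hx =>
          obtain ⟨l, rfl⟩ := hx
          exact (hψword l).mem_functionRing (sum_degZero _)
        | zero => rw [map_zero]; exact Subalgebra.zero_mem _
        | add x y _ _ hx hy => rw [map_add]; exact Subalgebra.add_mem _ hx hy
        | smul r x _ hx => rw [map_smul]; exact Subalgebra.smul_mem _ hx r
      change Ψ _ ∈ _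
      rw [map_mul, map_inv₀, hΨ, hΨ]
      exact Subalgebra.mul_mem _ (inv_mem_functionRing (hmem t)) (hmem s)
    · rintro _ ⟨d, f, hf', g, hg, hg0, rfl⟩
      have hX := (IsMonomial.word (D := Frac ω) (f := toFracAlg ω) (List.replicate d 0)).inv
      set X := toFracAlg ω (word ω (List.replicate d 0))
      have key : ∀ s ∈ homog ω d, toFrac ω s * X⁻¹ ∈ Ψ.range := by
        intro s hs
        have h := homog_le ω d hs
        clear hs
        induction h using Submodule.span_induction with
        | mem x hx =>
          obtain ⟨l, hl, rfl⟩ := hx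
          refine IsMonomial.mem_of_mem_exponents hf (hexp _ ?_)
            ((IsMonomial.word (D := Frac ω) (f := toFracAlg ω) l).mul hX)
          have hc : ∀ l : List (Fin (m + 1)), ∑ i, (cnt l i : ℤ) = l.length := fun l => by
            rw [← Nat.cast_sum, sum_cnt]
          simp only [Pi.add_apply, Pi.neg_apply, Finset.sum_add_distrib, Finset.sum_neg_distrib,
            hc]
          rw [show l.length = d from hl, List.length_replicate, add_neg_cancel]
        | zero => rw [map_zero, zero_mul]; exact Subalgebra.zero_mem _
        | add x y _ _ hx hy => rw [map_add, add_mul]; exact Subalgebra.add_mem _ hx hy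
        | smul r x _ hx =>
          rw [← toFracAlg_apply, map_smul, smul_mul_assoc]
          exact Subalgebra.smul_mem _ hx r
      obtain ⟨y1, h1⟩ := key f hf'
      obtain ⟨y2, h2⟩ := key g hg
      refine ⟨y1 * y2⁻¹, ?_⟩
      change Ψ _ = _
      change Ψ y1 = _ at h1
      change Ψ y2 = _ at h2
      have hX0 : X⁻¹ ≠ 0 := hX.ne_zero hf
      rw [map_mul, map_inv₀, h1, h2, mul_inv_rev, mul_assoc, mul_inv_cancel_left₀ hX0]
  exact ⟨(AlgEquiv.ofInjective Ψ hΨinj).trans (Subalgebra.equivOfEq _ _ hrange)⟩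

theorem birational_of_congruence (ω ω' : Params K (m + 1))
    (A : Matrix.GeneralLinearGroup (Fin m) ℤ)
    (hA : ∀ i j, (cycParams ω').val i j =
      ∏ k, ∏ l, (cycParams ω).val k l ^ (A.val k i * A.val l j)) : Birational ω ω' := by
  obtain ⟨e⟩ := nonempty_frac_equiv_functionRing ω (cycParams ω') A hA
  obtain ⟨e'⟩ := nonempty_frac_equiv_functionRing ω' (cycParams ω') 1 fun i j => by
    rw [Units.val_one, ← chi_mulVec, Matrix.one_mulVec, Matrix.one_mulVec, chi_single]
  exact ⟨e.symm.trans e'⟩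

theorem exists_matrix_of_birational {ω ω' : Params K (m + 1)} (h : Birational ω' ω) :
    ∃ A : Matrix (Fin m) (Fin m) ℤ, ∀ i j, (cycParams ω').val i j =
      ∏ k, ∏ l, (cycParams ω).val k l ^ (A k i * A l j) := by
  obtain ⟨φ⟩ := h
  have hf := toFracAlg_injective ω'
  choose z hz using fun i : Fin m => exists_isMonomial (D := Frac ω') (toFracAlg ω')
    (degZero m (Pi.single i 1))
  let y : Fin m → functionRing ω' := fun i => ⟨z i, (hz i).mem_functionRing (sum_degZero _)⟩
  have hy0 : ∀ i, y i ≠ 0 := fun i h0 => (hz i).ne_zero hf (congrArg Subtype.val h0)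
  have hcomm : ∀ i j, y j * y i = (cycParams ω').val i j • (y i * y j) := by
    intro i j
    refine Subtype.ext ?_
    change z j * z i = (cycParams ω').val i j • (z i * z j)
    rw [(hz i).comm hf (hz j), chi_degZero, chi_single]
  obtain ⟨a, ha0, ha⟩ := exists_chi_eq ω (c := (cycParams ω').val)
    (y := fun i => (φ (y i) : Frac ω)) (fun i => (φ (y i)).2)
    (fun i h0 => hy0 i ((map_eq_zero_iff φ φ.injective).1 (Subtype.ext h0)))
    (fun i j => by
      have := congrArg φ (hcomm i j)
      rw [map_mul, map_smul, map_mul] at this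
      exact congrArg Subtype.val this)
  refine ⟨fun k i => a i k.succ, fun i j => ?_⟩
  rw [ha, ← degZero_tail (ha0 i), ← degZero_tail (ha0 j), chi_degZero, chi_eq_prod]

end Main

end NCProj

theorem mainTheorem2 {K : Type*} [Field K] [IsAlgClosed K] [CharZero K] (m : ℕ)
    (ω ω' : NCProj.Params K (m + 1)) :
    ((∃ A : Matrix.GeneralLinearGroup (Fin m) ℤ, ∀ i j : Fin m,
        (NCProj.cycParams ω').val i j =
          ∏ k : Fin m, ∏ l : Fin m, (NCProj.cycParams ω).val k l ^ (A.val k i * A.val l j)) →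
      NCProj.Birational ω ω') ∧
    (NCProj.IsGeneric (NCProj.cycParams ω) → NCProj.Birational ω ω' →
      ∃ A : Matrix.GeneralLinearGroup (Fin m) ℤ, ∀ i j : Fin m,
        (NCProj.cycParams ω').val i j =
          ∏ k : Fin m, ∏ l : Fin m, (NCProj.cycParams ω).val k l ^ (A.val k i * A.val l j)) := by
  refine ⟨fun ⟨A, hA⟩ => NCProj.birational_of_congruence ω ω' A hA, fun hq hb => ?_⟩
  obtain ⟨A, hA⟩ := NCProj.exists_matrix_of_birational (hb.map AlgEquiv.symm)
  obtain ⟨B, hB⟩ := NCProj.exists_matrix_of_birational hb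
  exact ⟨(NCProj.isUnit_of_mutual_congruence hq.pairing_nondegenerate hA hB).unit, hA⟩
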